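/- **Setting.** Let $\bar{\mathbb C}=\mathbb C\cup\{-\infty\}$, with the log-disks $\{\operatorname{Re}w<\mathfrak r\}\ni-\infty$ as basic neighbourhoods of $-\infty$, and $e^{-\infty}=0$, $\operatorname{Im}(-\infty)=0$, $-\infty+c=-\infty$. For $D\subseteq\bar{\mathbb C}^m$ whose finite part $D\cap\mathbb C^m$ is a domain, $f:D\to\mathbb C$ is *log-holomorphic* if it is continuous and holomorphic on $D\cap\mathbb C^m$; $\|f\|_D$ is its sup norm. A set $\Delta\subseteq[0,\infty)^m$ is *natural* if it is contained in a product of sets $A_i\subseteq[0,\infty)$ such that each $A_i\cap[0,a)$ is finite. Let $\mathcal T_m$ be the set of tuples $\tau=(K,R,r,\theta,\Delta)$ with $K\subseteq[0,\infty)^m$ finite and non-empty, $R\in(0,\infty)^m$, $r>1$, $\theta>\pi/2$, and $\Delta\subseteq[0,\infty)^m$ natural and closed under addition. For $p\in\mathbb N$ put $$D_p=\Big\{z\in\mathbb C^m:\ |z_i|<R_i\ (1\le i\le m),\ \prod_i|z_i|^{k_i}<\tfrac1{1+p}\prod_iR_i^{k_i}\ \text{ for all } k\in K\setminus\{0\}\Big\},$$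 $$S^\tau=\Big\{w\in\bar{\mathbb C}^m:\ |e^{w_i}|<R_i\ (1\le i\le m),\ \sum_ik_i|\operatorname{Im}w_i|<\theta\ \text{ for all }k\in K\Big\},$$ and let $S^\tau_p$ be the set of $w\in\bar{\mathbb C}^m$ with $|e^{w_i}|<R_i$ for all $i$ such that every $k\in K\setminus\{0\}$ satisfies $\sum_ik_i|\operatorname{Im}w_i|<\theta$ or $\prod_i|e^{w_i}|^{k_i}<\frac1{1+p}\prod_iR_i^{k_i}$. A generalized power series $F=\sum_{\alpha\in[0,\infty)^m}a_\alpha X^\alpha$ has complex coefficients and support in a product of well-ordered subsets of $[0,\infty)$. Put $\|F\|_s=\sum_\alpha|a_\alpha|s^\alpha$ for $s\in(0,\infty)^m$, $\|F\|_{D_p}=\sup\{\|F\|_s:\ s\in\overline{D_p}\cap(0,\infty)^m\}$, and $\bar F(w)=\sum_\alpha a_\alpha e^{\alpha\cdot w}$ where this converges absolutely (with $e^{a\cdot(-\infty)}=0$ for $a>0$ and $=1$ for $a=0$). We write $f=_\tau\sum_pf_p$ with $T(f_p)=F_p$ if each $f_p:S^\tau_p\to\mathbb C$ is log-holomorphic,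 each $F_p$ is a generalized power series with support in $\Delta$ and $f_p=\bar F_p$ on $\{w:e^w\in D_p\}$, $\sum_p\|F_p\|_{D_p}r^p<\infty$, $\sum_p\|f_p\|_{S^\tau_p}r^p<\infty$, and $f=\sum_pf_p$ on $S^\tau$. Then $\|f\|_\tau$ is the infimum of $\max\{\sum_p\|F_p\|_{D_p}r^p,\sum_p\|f_p\|_{S^\tau_p}r^p\}$ over all such representations of $f$, $\mathcal G_\tau$ is the set of all $f$ that have one, and $Tf=\sum_pF_p$ (coefficientwise). Let $\mathbb C\{X^*\}_\tau=T(\mathcal G_\tau)$; a function $f$ with $Tf=F$ is called the sum of $F$ ($T$ is injective), and $\|F\|_\tau=\inf\{\|f\|_\tau:Tf=F\}$, that is, $\|Tf\|_\tau=\|f\|_\tau$. For $\rho\in(0,\infty)^n$, let $\mathbb C\{X^*,Y\}_{\tau,\rho}$ be the set of $F=\sum_{\beta\in\mathbb N^n}F_\beta(X)Y^\beta$ with $F_\beta\in\mathbb C\{X^*\}_\tau$ and $\|F\|_{\tau,\rho}=\sum_\beta\|F_\beta\|_\tau\rho^\beta<\infty$. A sum of $F$ is a function $\bar F(w,y)=\sum_\beta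 f_\beta(w)y^\beta$ on $S^\tau\times D(\rho)$, $D(\rho)=\{y:|y_j|<\rho_j\text{ for all }j\}$, where $f_\beta$ is the sum of $F_\beta$ and $\sum_\beta\|f_\beta\|_\tau\rho^\beta<\infty$. **Blow-up.** Let $i\ne j$ in $\{1,\dots,m\}$ and $\lambda>0$. Index the entries of $X'$ by $\{1,\dots,m\}\setminus\{i\}$ (keeping the order), and let $Y'=(Y'_0,Y_1,\dots,Y_n)$. The regular blow-up chart $\sigma$ is given by $\sigma(X_a)=X'_a$ for $a\ne i$, $\sigma(X_i)=X'_j(\lambda+Y'_0)$, $\sigma(Y_b)=Y_b$; it extends to generalized series through $(\lambda+Y'_0)^{c}=\sum_\nu\binom c\nu\lambda^{c-\nu}(Y_0')^\nu$, $c\ge0$. Put $\tilde\sigma(w',y')=(w,y)$ with $w_a=w'_a$ for $a\neq i$, $w_i=w'_j+\log(\lambda+y'_0)$ (principal branch), $y=(y'_1,\dots,y'_n)$. For $\alpha\in[0,\infty)^m$ let $\alpha'\in[0,\infty)^{m-1}$ arise from $\alpha$ by deleting the entry $\alpha_i$ and replacing the entry $\alpha_j$ by $\alpha_j+\alpha_i$.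 **Proposition.** Let $\tau=(K,R,r,\theta,\Delta)\in\mathcal T_m$ and $\rho\in(0,\infty)^n$. Let $\theta'\in(\pi/2,\theta)$ and $0<\rho_0<\lambda/2$ be such that $k_i|\arg(\lambda+v)|<\theta-\theta'$ for all $k\in K$ and all $v\in\mathbb C$ with $|v|<2\rho_0$. Put $l=\max(\{1\}\cup\{k_i:k\in K\})$, $R'_a=R_a$ for $a\ne i,j$, $$R'_j=\min\Big\{R_j,\ R_i,\ \frac{R_i}{(\lambda+2\rho_0)^l}\Big\},$$ $K'=\{k':k\in K\}$, $\Delta'=\{\alpha':\alpha\in\Delta\}$, $\tau'=(K',R',r,\theta',\Delta')\in\mathcal T_{m-1}$ and $\rho'=(\rho_0,\rho)$. Then $\tilde\sigma$ maps $S^{\tau'}\times D(\rho')$ into $S^\tau\times D(\rho)$, and there is a constant $C\ge1$ such that, for every $F\in\mathbb C\{X^*,Y\}_{\tau,\rho}$: $\sigma F\in\mathbb C\{(X')^*,Y'\}_{\tau',\rho'}$; $F$ has a sum, and for every sum $\bar F$ of $F$ the function $\bar F\circ\tilde\sigma$ is a sum of $\sigma F$ (i.e. $\overline{\sigma F}=\bar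 F\circ\tilde\sigma$); and $\|\sigma F\|_{\tau',\rho'}\le C\,\|F\|_{\tau,\rho}$. -/

import Mathlib

open scoped NNReal ENNReal

noncomputable section

/-! ### The logarithmic chart -/

/-- The logarithmic chart `ℂ ∪ {-∞}` of the Riemann surface of the logarithm. -/
inductive LogPlane : Type
  | negInf : LogPlane
  | fin : ℂ → LogPlane

namespace LogPlane

/-- The exponential function, with `exp (-∞) = 0`. -/
def exp : LogPlane → ℂ
  | negInf => 0
  | fin z => Complex.exp z

/-- The imaginary part, with `im (-∞) = 0`. -/
def im : LogPlane → ℝ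
  | negInf => 0
  | fin z => z.im

/-- The function `w ↦ e ^ (a w)` for a real exponent `a ≥ 0`, extended continuously to `-∞`. -/
def expMul (a : ℝ≥0) : LogPlane → ℂ
  | negInf => if a = 0 then 1 else 0
  | fin z => Complex.exp ((a : ℝ) * z)

/-- Translation by a complex number; it fixes `-∞`. -/
def translate (c : ℂ) : LogPlane → LogPlane
  | negInf => negInf
  | fin z => fin (z + c)

/-- The log-disk `{w : Re w < r}`, which contains `-∞`. -/
def logDisk (r : ℝ) : Set LogPlane :=
  {w | match w with
    | negInf => True
    | fin z => z.re < r}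

/-- The topology of `ℂ`, with the log-disks as basic open neighbourhoods of `-∞`. -/
instance : TopologicalSpace LogPlane where
  IsOpen U := IsOpen (fin ⁻¹' U) ∧ (negInf ∈ U → ∃ r : ℝ, logDisk r ⊆ U)
  isOpen_univ := ⟨by simp, fun _ => ⟨0, Set.subset_univ _⟩⟩
  isOpen_inter := by
    rintro U V ⟨hU, hU'⟩ ⟨hV, hV'⟩
    refine ⟨hU.inter hV, ?_⟩
    rintro ⟨h1, h2⟩
    obtain ⟨r, hr⟩ := hU' h1
    obtain ⟨s, hs⟩ := hV' h2
    refine ⟨min r s, fun w hw => ?_⟩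
    cases w with
    | negInf => exact ⟨h1, h2⟩
    | fin z =>
      have hz : z.re < min r s := hw
      exact ⟨hr (show z.re < r from lt_of_lt_of_le hz (min_le_left _ _)),
        hs (show z.re < s from lt_of_lt_of_le hz (min_le_right _ _))⟩
  isOpen_sUnion := by
    intro S hS
    refine ⟨?_, ?_⟩
    · rw [Set.preimage_sUnion]
      exact isOpen_biUnion fun U hU => (hS U hU).1
    · rintro ⟨U, hU, h⟩
      obtain ⟨r, hr⟩ := (hS U hU).2 h
      exact ⟨r, fun w hw => ⟨U, hU, hr hw⟩⟩

end LogPlane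

/-- Log-holomorphic functions on a set `D` of points of the `m`-th power of the logarithmic chart:
continuous on `D`, and holomorphic on the finite part of `D`. (It is only used for sets `D` whose
finite part is a domain in `ℂ ^ m`.) -/
def LogHolomorphicOn {m : ℕ} (f : (Fin m → LogPlane) → ℂ) (D : Set (Fin m → LogPlane)) : Prop :=
  ContinuousOn f D ∧
    DifferentiableOn ℂ (fun z : Fin m → ℂ => f fun i => LogPlane.fin (z i))
      {z | (fun i => LogPlane.fin (z i)) ∈ D}

/-- The sup norm of `f` on `D`. -/
def supNormOn {X : Type} (f : X → ℂ) (D : Set X) : ℝ≥0∞ := ⨆ x ∈ D, ‖f x‖ₑ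

/-! ### Generalized power series -/

/-- Generalized power series `∑ a_α X ^ α`, `α ∈ [0, ∞) ^ m`, with complex coefficients. The support
of a Hahn series is partially well-ordered; in `[0, ∞) ^ m` this says that it is contained in a
cartesian product of well-ordered subsets of `[0, ∞)`. -/
abbrev GenSeries (m : ℕ) : Type := HahnSeries (Fin m → ℝ≥0) ℂ

/-- The norm `‖F‖_s = ∑ |a_α| s ^ α` for a polyradius `s`. -/
def GenSeries.radiusNorm {m : ℕ} (F : GenSeries m) (s : Fin m → ℝ) : ℝ≥0∞ :=
  ∑' α : Fin m → ℝ≥0, ‖F.coeff α‖ₑ * ENNReal.ofReal (∏ i, s i ^ (α i : ℝ))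

/-- The norm `‖F‖_U`, the supremum of `‖F‖_s` over all polyradii `s` in the closure of `U`. -/
def GenSeries.domainNorm {m : ℕ} (F : GenSeries m) (U : Set (Fin m → ℂ)) : ℝ≥0∞ :=
  ⨆ s ∈ {s : Fin m → ℝ | (∀ i, 0 < s i) ∧ (fun i => (s i : ℂ)) ∈ closure U}, F.radiusNorm s

/-- `z` is the value at `w` of the log-sum `∑ a_α e ^ (α · w)` of `F`. -/
def GenSeries.HasLogSumAt {m : ℕ} (F : GenSeries m) (w : Fin m → LogPlane) (z : ℂ) : Prop :=
  HasSum (fun α : Fin m → ℝ≥0 => F.coeff α * ∏ i, (w i).expMul (α i)) z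

/-- Natural subsets of `[0, ∞) ^ m`: those contained in a product of sets `A i` of reals that have
only finitely many elements below any bound. -/
def IsNatural {m : ℕ} (Δ : Set (Fin m → ℝ≥0)) : Prop :=
  ∃ A : Fin m → Set ℝ≥0, (∀ i a, (A i ∩ Set.Iio a).Finite) ∧ Δ ⊆ Set.univ.pi A

/-! ### Generalized multisummable functions -/

/-- The set `𝓣_m` of all tuples `τ = (K, R, r, θ, Δ)`. -/
structure MultiParam (m : ℕ) where
  K : Set (Fin m → ℝ≥0)
  K_finite : K.Finite
  K_nonempty : K.Nonempty
  R : Fin m → ℝ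
  R_pos : ∀ i, 0 < R i
  r : ℝ
  one_lt_r : 1 < r
  θ : ℝ
  lt_θ : Real.pi / 2 < θ
  Δ : Set (Fin m → ℝ≥0)
  natural : IsNatural Δ
  add_mem : ∀ α ∈ Δ, ∀ β ∈ Δ, α + β ∈ Δ

namespace MultiParam

variable {m : ℕ}

/-- The condition on `z` that defines the `k`-polydisk of index `p`: `|z| ^ k < R ^ k / (1 + p)`.
No condition is imposed for `k = 0`. -/
def InDisk (τ : MultiParam m) (k : Fin m → ℝ≥0) (p : ℕ) (z : Fin m → ℂ) : Prop :=
  k = 0 ∨ ∏ i, ‖z i‖ ^ (k i : ℝ) < (∏ i, τ.R i ^ (k i : ℝ)) / (1 + p)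

/-- The polydisk `D(R)`. -/
def disk (τ : MultiParam m) : Set (Fin m → ℂ) := {z | ∀ i, ‖z i‖ < τ.R i}

/-- The intersection `D_p(R)` of the `k`-polydisks of index `p`, for `k ∈ K`. -/
def diskP (τ : MultiParam m) (p : ℕ) : Set (Fin m → ℂ) :=
  {z | z ∈ τ.disk ∧ ∀ k ∈ τ.K, τ.InDisk k p z}

/-- The logarithmic version of `D_p(R)`. -/
def logDiskP (τ : MultiParam m) (p : ℕ) : Set (Fin m → LogPlane) :=
  {w | (fun i => (w i).exp) ∈ τ.diskP p}

/-- The condition on `w` that defines the `k`-polysector: `k · |Im w| < θ`. -/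
def InSector (τ : MultiParam m) (k : Fin m → ℝ≥0) (w : Fin m → LogPlane) : Prop :=
  ∑ i, (k i : ℝ) * |(w i).im| < τ.θ

/-- The domain `S^τ`. The condition `Re w < log R` is stated as `|e ^ w| < R`. -/
def S (τ : MultiParam m) : Set (Fin m → LogPlane) :=
  {w | (fun i => (w i).exp) ∈ τ.disk ∧ ∀ k ∈ τ.K, τ.InSector k w}

/-- The domain `S^τ_p`: the intersection over `k ∈ K` of the unions of the `k`-polysector with
the log-`k`-polydisk of index `p`. -/
def SP (τ : MultiParam m) (p : ℕ) : Set (Fin m → LogPlane) :=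
  {w | (fun i => (w i).exp) ∈ τ.disk ∧
    ∀ k ∈ τ.K, τ.InSector k w ∨ τ.InDisk k p fun i => (w i).exp}

/-- `∑_p ‖F_p‖ r ^ p`, where the norm of `F_p` is that of `D_p(R)`. -/
def seriesSum (τ : MultiParam m) (Fp : ℕ → GenSeries m) : ℝ≥0∞ :=
  ∑' p, (Fp p).domainNorm (τ.diskP p) * ENNReal.ofReal (τ.r ^ p)

/-- `∑_p ‖f_p‖ r ^ p`, where the norm of `f_p` is the sup norm on `S^τ_p`. -/
def funSum (τ : MultiParam m) (fp : ℕ → (Fin m → LogPlane) → ℂ) : ℝ≥0∞ :=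
  ∑' p, supNormOn (fp p) (τ.SP p) * ENNReal.ofReal (τ.r ^ p)

/-- `f =_τ ∑_p f_p`, where `F_p` is the series `T(f_p)`. -/
structure IsDecomposition (τ : MultiParam m) (f : (Fin m → LogPlane) → ℂ)
    (fp : ℕ → (Fin m → LogPlane) → ℂ) (Fp : ℕ → GenSeries m) : Prop where
  logHolomorphic : ∀ p, LogHolomorphicOn (fp p) (τ.SP p)
  support_subset : ∀ p, (Fp p).support ⊆ τ.Δ
  hasLogSum : ∀ p, ∀ w ∈ τ.logDiskP p, (Fp p).HasLogSumAt w (fp p w)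
  seriesSum_lt_top : τ.seriesSum Fp < ⊤
  funSum_lt_top : τ.funSum fp < ⊤
  hasSum : ∀ w ∈ τ.S, HasSum (fun p => fp p w) (f w)

/-- The norm `‖f‖_τ`; it is finite if and only if `f` belongs to `𝓖_τ`. -/
def funNorm (τ : MultiParam m) (f : (Fin m → LogPlane) → ℂ) : ℝ≥0∞ :=
  ⨅ (fp : ℕ → (Fin m → LogPlane) → ℂ) (Fp : ℕ → GenSeries m) (_ : τ.IsDecomposition f fp Fp),
    max (τ.seriesSum Fp) (τ.funSum fp)

/-- `f` belongs to `𝓖_τ` and `T f = F`, i.e. `F = ∑_p T(f_p)` coefficientwise for some sequence with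
`f =_τ ∑_p f_p`. In this case `f` is the sum of `F`. -/
def HasExpansion (τ : MultiParam m) (f : (Fin m → LogPlane) → ℂ) (F : GenSeries m) : Prop :=
  ∃ fp Fp, τ.IsDecomposition f fp Fp ∧ ∀ α, HasSum (fun p => (Fp p).coeff α) (F.coeff α)

/-- `ℂ{X*}_τ`, the image of `𝓖_τ` under `T`. -/
def series (τ : MultiParam m) : Set (GenSeries m) := {F | ∃ f, τ.HasExpansion f F}

/-- The norm on `ℂ{X*}_τ`, given by `‖T f‖_τ = ‖f‖_τ`; it is `∞` outside `ℂ{X*}_τ`. -/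
def seriesNorm (τ : MultiParam m) (F : GenSeries m) : ℝ≥0∞ :=
  ⨅ (f : (Fin m → LogPlane) → ℂ) (_ : τ.HasExpansion f F), τ.funNorm f

end MultiParam

/-! ### Mixed series -/

/-- Mixed series `∑_β F_β(X) Y ^ β`, `β ∈ ℕ ^ n`, in which every `F_β` is a generalized power series;
`F_β` is `MvPowerSeries.coeff β F`. -/
abbrev MixedSeries (m n : ℕ) : Type := MvPowerSeries (Fin n) (GenSeries m)

/-- The open polydisk `D(ρ)`. -/
def polydisk {n : ℕ} (ρ : Fin n → ℝ) : Set (Fin n → ℂ) := {y | ∀ j, ‖y j‖ < ρ j}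

namespace MultiParam

variable {m n : ℕ}

/-- The norm `‖F‖_{τ,ρ} = ∑_β ‖F_β‖_τ ρ ^ β`. -/
def mixedNorm (τ : MultiParam m) (ρ : Fin n → ℝ) (F : MixedSeries m n) : ℝ≥0∞ :=
  ∑' β : Fin n →₀ ℕ, τ.seriesNorm (MvPowerSeries.coeff β F) * ENNReal.ofReal (∏ j, ρ j ^ β j)

/-- `ℂ{X*, Y}_{τ,ρ}`. -/
def mixedSeries (τ : MultiParam m) (ρ : Fin n → ℝ) : Set (MixedSeries m n) :=
  {F | (∀ β, MvPowerSeries.coeff β F ∈ τ.series) ∧ τ.mixedNorm ρ F < ⊤}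

/-- `g` is the sum of the mixed series `F` on `S^τ × D(ρ)`: `g(w, y) = ∑_β f_β(w) y ^ β` where `f_β`
is the sum of `F_β` for each `β` and `∑_β ‖f_β‖_τ ρ ^ β < ∞`. -/
def IsMixedSum (τ : MultiParam m) (ρ : Fin n → ℝ) (F : MixedSeries m n)
    (g : (Fin m → LogPlane) × (Fin n → ℂ) → ℂ) : Prop :=
  ∃ f : (Fin n →₀ ℕ) → (Fin m → LogPlane) → ℂ,
    (∀ β, τ.HasExpansion (f β) (MvPowerSeries.coeff β F)) ∧
    ∑' β : Fin n →₀ ℕ, τ.funNorm (f β) * ENNReal.ofReal (∏ j, ρ j ^ β j) < ⊤ ∧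
    ∀ w ∈ τ.S, ∀ y ∈ polydisk ρ,
      HasSum (fun β : Fin n →₀ ℕ => f β w * ∏ j, y j ^ β j) (g (w, y))

end MultiParam

/-! ### Regular blow-up charts

The Gevrey variables are `X_0, …, X_M`. The chart with indices `i` and `j` is `X_i ↦ X'_j (lam + Y'_0)`
together with `X_(i.succAbove a) ↦ X'_a` for `a : Fin M`, and `Y_l ↦ Y'_(l+1)`; so the variable
`X_i` is replaced, and `X'_j` is the new name of the variable `X_(i.succAbove j)`, which is
different from `X_i`. -/

section BlowUp

variable {M n : ℕ} (i : Fin (M + 1)) (j : Fin M)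

/-- The action on exponents: `X ^ α` is mapped to `X' ^ (collapse i j α) * (lam + Y'_0) ^ (α i)`. -/
def collapse (α : Fin (M + 1) → ℝ≥0) : Fin M → ℝ≥0 :=
  fun a => α (i.succAbove a) + if a = j then α i else 0

lemma collapse_mono : Monotone (collapse i j) := by
  intro α β h a
  unfold collapse
  refine add_le_add (h _) ?_
  split_ifs
  · exact h i
  · exact le_rfl

lemma collapse_add (α β : Fin (M + 1) → ℝ≥0) :
    collapse i j (α + β) = collapse i j α + collapse i j β := by
  funext a
  simp only [collapse, Pi.add_apply]
  split_ifs <;> ring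

/-- The sum below that defines the coefficients of a blow-up is finite. -/
lemma finite_collapse_fiber (F : GenSeries (M + 1)) (γ : Fin M → ℝ≥0) :
    {α | α ∈ F.support ∧ collapse i j α = γ}.Finite := by
  have hpwo : ({α | α ∈ F.support ∧ collapse i j α = γ} : Set (Fin (M + 1) → ℝ≥0)).IsPWO :=
    F.isPWO_support.mono fun α h => h.1
  refine IsAntichain.finite_of_partiallyWellOrderedOn ?_ hpwo
  rintro α ⟨_, hα⟩ β ⟨_, hβ⟩ hne hle
  apply hne
  have key : ∀ a, collapse i j α a = collapse i j β a := fun a => by rw [hα, hβ]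
  have hi : α i = β i := by
    have h1 := key j
    simp only [collapse, if_true] at h1
    refine le_antisymm (hle i) ?_
    by_contra hlt
    push Not at hlt
    exact absurd h1 (ne_of_lt (add_lt_add_of_le_of_lt (hle _) hlt))
  funext b
  rcases Fin.eq_self_or_eq_succAbove i b with rfl | ⟨a, rfl⟩
  · exact hi
  · have h1 := key a
    simp only [collapse, hi] at h1
    exact add_right_cancel h1

/-- The coefficient of `Y'_0 ^ ν` in the blow-up of a series `F` in `X` only. By the binomial series
`(lam + Y) ^ a = ∑_ν binom(a, ν) lam ^ (a - ν) Y ^ ν`, its coefficient at `X' ^ γ` is the sum over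
all `α` with `collapse i j α = γ` of `F_α binom(α i, ν) lam ^ (α i - ν)`. -/
def GenSeries.blowUpCoeff (lam : ℝ) (F : GenSeries (M + 1)) (ν : ℕ) : GenSeries M where
  coeff γ := ∑ᶠ (α : Fin (M + 1) → ℝ≥0) (_ : collapse i j α = γ),
    F.coeff α * ((Ring.choose (α i : ℝ) ν * lam ^ ((α i : ℝ) - ν) : ℝ) : ℂ)
  isPWO_support' := by
    refine (F.isPWO_support.image_of_monotone (collapse_mono i j)).mono ?_
    intro γ hγ
    obtain ⟨α, hα⟩ := exists_ne_zero_of_finsum_mem_ne_zero hγ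
    exact ⟨α, left_ne_zero_of_mul hα.2, hα.1⟩

/-- The blow-up `σF` of a mixed series; the new convergent variable comes first. -/
def MixedSeries.blowUp (lam : ℝ) (F : MixedSeries (M + 1) n) : MixedSeries M (n + 1) :=
  fun β => GenSeries.blowUpCoeff i j lam (MvPowerSeries.coeff (Finsupp.tail β) F) (β 0)

/-- The map `σ̃` on points: `w_i = w'_j + log (lam + y'_0)`, with the principal branch of `log`. -/
def blowUpMap (lam : ℝ) (x : (Fin M → LogPlane) × (Fin (n + 1) → ℂ)) :
    (Fin (M + 1) → LogPlane) × (Fin n → ℂ) :=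
  (i.insertNth ((x.1 j).translate (Complex.log (lam + x.2 0))) x.1, Fin.tail x.2)

/-- The exponent `l`, the maximum of `1` and all `k i` for `k ∈ K`. -/
def blowUpExponent (τ : MultiParam (M + 1)) : ℝ :=
  sSup (insert 1 ((fun k : Fin (M + 1) → ℝ≥0 => (k i : ℝ)) '' τ.K))

/-- The polyradius `R'`: only its entry for `X'_j` differs from the corresponding entry of `R`. -/
def blowUpRadius (lam ρ₀ : ℝ) (τ : MultiParam (M + 1)) : Fin M → ℝ := fun a =>
  if a = j then
    min (τ.R (i.succAbove j))
      (min (τ.R i) (τ.R i / (lam + 2 * ρ₀) ^ blowUpExponent i τ))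
  else τ.R (i.succAbove a)

lemma IsNatural.collapse_image {Δ : Set (Fin (M + 1) → ℝ≥0)} (h : IsNatural Δ) :
    IsNatural (collapse i j '' Δ) := by
  obtain ⟨A, hA, hΔ⟩ := h
  refine ⟨fun a => Set.image2 (fun x y => x + if a = j then y else 0) (A (i.succAbove a)) (A i),
    ?_, ?_⟩
  · intro a c
    by_cases haj : a = j
    · refine ((hA (i.succAbove a) c).image2 (fun x y => x + y) (hA i c)).subset ?_
      rintro _ ⟨⟨x, hx, y, hy, rfl⟩, hlt⟩
      simp only [if_pos haj] at hlt ⊢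
      exact ⟨x, ⟨hx, Set.mem_Iio.2 (lt_of_le_of_lt le_self_add hlt)⟩, y,
        ⟨hy, Set.mem_Iio.2 (lt_of_le_of_lt le_add_self hlt)⟩, rfl⟩
    · refine (hA (i.succAbove a) c).subset ?_
      rintro _ ⟨⟨x, hx, y, hy, rfl⟩, hlt⟩
      simp only [if_neg haj, add_zero] at hlt ⊢
      exact ⟨hx, hlt⟩
  · rintro _ ⟨α, hα, rfl⟩ a _
    exact ⟨α _, hΔ hα _ trivial, α i, hΔ hα _ trivial, rfl⟩

/-- The parameter `τ' = (K', R', r, θ', Δ')`. -/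
def MultiParam.blowUp (lam ρ₀ θ' : ℝ) (hlam : 0 < lam) (hρ₀ : 0 < ρ₀) (hθ' : Real.pi / 2 < θ')
    (τ : MultiParam (M + 1)) : MultiParam M where
  K := collapse i j '' τ.K
  K_finite := τ.K_finite.image _
  K_nonempty := τ.K_nonempty.image _
  R := blowUpRadius i j lam ρ₀ τ
  R_pos a := by
    have h : 0 < lam + 2 * ρ₀ := by positivity
    unfold blowUpRadius
    split_ifs
    · exact lt_min (τ.R_pos _)
        (lt_min (τ.R_pos _) (div_pos (τ.R_pos _) (Real.rpow_pos_of_pos h _)))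
    · exact τ.R_pos _
  r := τ.r
  one_lt_r := τ.one_lt_r
  θ := θ'
  lt_θ := hθ'
  Δ := collapse i j '' τ.Δ
  natural := τ.natural.collapse_image i j
  add_mem := by
    rintro _ ⟨α, hα, rfl⟩ _ ⟨β, hβ, rfl⟩
    exact ⟨α + β, τ.add_mem α hα β hβ, collapse_add i j α β⟩

end BlowUp

end

/-! Freeze `w` in `S^τ'` and let only the new variable `v = y'_0` move. For a term `f_p` of a
decomposition of `f`, the function `v ↦ f_p(σ̃(w, v))` is holomorphic for `|v| < 2ρ₀`. Its Taylor
coefficient of index `ν`, as a function of `w`, is the candidate for the sum of the coefficient of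
`Y'_0 ^ ν` in `σF`. Everything reduces to Cauchy estimates and absolutely convergent rearrangements.

Geometry (`blowUpPoint_mem_SP`): the translation by `log (lam + v)` changes an imaginary part by at
most `|arg (lam + v)|`, which the gap `θ - θ'` pays for, while the choice of `R'` absorbs the factor
`|lam + v| ≤ lam + 2ρ₀`. Hence `S^τ'_p` together with `|v| < 2ρ₀` goes into `S^τ_p` with the same
`p`, and a decomposition can be blown up term by term.

Functions and series: Taylor coefficients inherit continuity and holomorphy in `w`, and Cauchy's
inequality on `|v| = r` bounds them by `r^(-ν) ‖f_p‖` for every `r < 2ρ₀`. On the series side the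
same inequality for `(lam + v)^a` bounds the binomial weights (`norm_blowUpWeight_mul_le`), so the
norms of the blown-up `F_p` satisfy the same bound. `hasSum_rearrange` identifies log-sums and sums
over `p`, which yields `IsDecomposition.blowUp`.

Mixed series: with `r = (3/2) ρ₀` the loss `r^(-ν)` against the weight `ρ₀^ν` is a geometric series
of ratio `2/3`, so `C = 3` works (`tsum_cons_weight_le`). Absolute convergence then allows summing
first over `ν`, which recovers `f_β ∘ σ̃`, and then over `β`. -/

/-! ### Taylor coefficients at the origin -/

section TaylorCoeff

open Metric Set Filter Topology

/-- The Taylor coefficient of index `ν` at the origin. -/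
noncomputable def taylorCoeff (φ : ℂ → ℂ) (ν : ℕ) : ℂ := (ν.factorial : ℂ)⁻¹ * iteratedDeriv ν φ 0

lemma hasSum_taylorCoeff {φ : ℂ → ℂ} {r : ℝ} (h : DifferentiableOn ℂ φ (ball 0 r)) {v : ℂ}
    (hv : ‖v‖ < r) : HasSum (fun ν => taylorCoeff φ ν * v ^ ν) (φ v) := by
  have := Complex.hasSum_taylorSeries_on_ball h (mem_ball_zero_iff.2 hv)
  refine this.congr_fun fun ν => ?_
  simp only [taylorCoeff, sub_zero, smul_eq_mul]
  ring

lemma taylorCoeff_eq_of_hasSum {φ : ℂ → ℂ} {r : ℝ} (hr : 0 < r) {c : ℕ → ℂ}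
    (h : ∀ v : ℂ, ‖v‖ < r → HasSum (fun ν => c ν * v ^ ν) (φ v)) (ν : ℕ) :
    taylorCoeff φ ν = c ν := by
  have hps : HasFPowerSeriesOnBall φ (FormalMultilinearSeries.ofScalars ℂ c) 0
      ((r / 2).toNNReal : ℝ≥0∞) := by
    refine ⟨?_, by simpa using hr, ?_⟩
    · apply FormalMultilinearSeries.le_radius_of_summable
      -- Convergence at the single point `r / 2` is automatically absolute, which bounds the radius
      -- of convergence from below.
      have h1 := (h ((r / 2 : ℝ) : ℂ) (by
        rw [Complex.norm_real, Real.norm_of_nonneg (by positivity)]; linarith)).summable.norm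
      refine h1.congr fun n => ?_
      rw [FormalMultilinearSeries.ofScalars_norm, norm_mul, norm_pow, Complex.norm_real,
        Real.norm_of_nonneg (by positivity), Real.coe_toNNReal _ (by positivity)]
    · intro y hy
      rw [zero_add]
      have hy' : ‖y‖ < r := by
        rw [Metric.eball_coe, mem_ball_zero_iff, Real.coe_toNNReal _ (by positivity)] at hy
        linarith
      refine (h y hy').congr_fun fun n => ?_
      rw [FormalMultilinearSeries.ofScalars_apply_eq, smul_eq_mul]
  have h2 := hps.factorial_smul 1 ν
  rw [FormalMultilinearSeries.ofScalars_apply_eq, ← iteratedDeriv_eq_iteratedFDeriv] at h2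
  rw [taylorCoeff, ← h2, one_pow, smul_eq_mul, mul_one, nsmul_eq_mul,
    inv_mul_cancel_left₀ (by exact_mod_cast ν.factorial_ne_zero)]

lemma norm_taylorCoeff_le {φ : ℂ → ℂ} {r C : ℝ} (hr : 0 < r)
    (h : DifferentiableOn ℂ φ (closedBall 0 r)) (hC : ∀ v ∈ sphere (0 : ℂ) r, ‖φ v‖ ≤ C) (ν : ℕ) :
    ‖taylorCoeff φ ν‖ ≤ C / r ^ ν := by
  have := Complex.norm_iteratedDeriv_le_of_forall_mem_sphere_norm_le ν hr
    (h.diffContOnCl_ball subset_rfl) hC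
  have hpos : (0 : ℝ) < ν.factorial := by exact_mod_cast ν.factorial_pos
  rw [taylorCoeff, norm_mul, norm_inv, Complex.norm_natCast]
  calc _ ≤ (ν.factorial : ℝ)⁻¹ * (ν.factorial * C / r ^ ν) := by gcongr
    _ = _ := by field_simp

lemma taylorCoeff_sub {φ ψ : ℂ → ℂ} {r : ℝ} (hr : 0 < r) (hφ : DifferentiableOn ℂ φ (ball 0 r))
    (hψ : DifferentiableOn ℂ ψ (ball 0 r)) (ν : ℕ) :
    taylorCoeff (fun v => φ v - ψ v) ν = taylorCoeff φ ν - taylorCoeff ψ ν := by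
  refine taylorCoeff_eq_of_hasSum (c := fun ν => taylorCoeff φ ν - taylorCoeff ψ ν) hr
    (fun v hv => ?_) ν
  refine ((hasSum_taylorCoeff hφ hv).sub (hasSum_taylorCoeff hψ hv)).congr_fun fun ν => ?_
  ring

/-- A sum of power series with summable majorants may be rearranged. -/
lemma hasSum_rearrange {ι : Type*} {φ : ℂ → ℂ} {ψ : ι → ℂ → ℂ} {c : ι → ℕ → ℂ} {r : ℝ} (hr : 0 < r)
    {b : ι → ℝ} (hb : Summable b) (hc : ∀ i ν, ‖c i ν‖ * r ^ ν ≤ b i)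
    (hψ : ∀ i v, ‖v‖ < r → HasSum (fun ν => c i ν * v ^ ν) (ψ i v))
    (hφ : ∀ v, ‖v‖ < r → HasSum (fun i => ψ i v) (φ v)) :
    (∀ ν, HasSum (fun i => c i ν) (taylorCoeff φ ν)) ∧
      ∀ v, ‖v‖ < r → HasSum (fun ν => taylorCoeff φ ν * v ^ ν) (φ v) := by
  have hsum : ∀ ν, Summable fun i => c i ν := fun ν =>
    Summable.of_norm_bounded (hb.div_const (r ^ ν)) fun i => by
      rw [le_div_iff₀ (by positivity)]; exact hc i ν
  have hser : ∀ v : ℂ, ‖v‖ < r → HasSum (fun ν => (∑' i, c i ν) * v ^ ν) (φ v) := by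
    intro v hv
    have hq : ‖v‖ / r < 1 := (div_lt_one hr).2 hv
    -- The double family is dominated by the product family `b i * (‖v‖ / r) ^ ν`, so both iterated
    -- sums exist and agree.
    have hdouble : Summable fun x : ι × ℕ => c x.1 x.2 * v ^ x.2 := by
      have hb0 : ∀ i, 0 ≤ b i := fun i => le_trans (by positivity) (hc i 0)
      have hgeo : Summable fun n : ℕ => (‖v‖ / r) ^ n :=
        summable_geometric_of_lt_one (by positivity) hq
      have hgeo0 : ∀ n : ℕ, 0 ≤ (‖v‖ / r) ^ n := fun n => by positivity
      refine Summable.of_norm_bounded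
        (g := fun x : ι × ℕ => b x.1 * (‖v‖ / r) ^ x.2)
        (hb.mul_of_nonneg hgeo hb0 hgeo0) fun x => ?_
      · rw [norm_mul, norm_pow, div_pow, mul_div_assoc', le_div_iff₀ (by positivity)]
        calc _ = (‖c x.1 x.2‖ * r ^ x.2) * ‖v‖ ^ x.2 := by ring
          _ ≤ _ := by gcongr; exact hc _ _
    have h1 : HasSum (fun x : ι × ℕ => c x.1 x.2 * v ^ x.2) (φ v) := by
      have := hdouble.hasSum.prod_fiberwise fun i => hψ i v hv
      rw [(hφ v hv).unique this]
      exact hdouble.hasSum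
    have h2 : HasSum (fun x : ℕ × ι => c x.2 x.1 * v ^ x.1) (φ v) :=
      (Equiv.prodComm ℕ ι).hasSum_iff.2 h1
    exact h2.prod_fiberwise fun ν => (hsum ν).hasSum.mul_right (v ^ ν)
  have heq : ∀ ν, taylorCoeff φ ν = ∑' i, c i ν := taylorCoeff_eq_of_hasSum hr hser
  refine ⟨fun ν => heq ν ▸ (hsum ν).hasSum, fun v hv => ?_⟩
  simp only [heq]
  exact hser v hv

/-- Taylor coefficients depend continuously on parameters. -/
lemma continuousOn_taylorCoeff {X : Type*} [TopologicalSpace X] {S : Set X} {G : X → ℂ → ℂ} {r : ℝ}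
    (hr : 0 < r) (hG : ContinuousOn G.uncurry (S ×ˢ ball 0 r))
    (hd : ∀ x ∈ S, DifferentiableOn ℂ (G x) (ball 0 r)) (ν : ℕ) :
    ContinuousOn (fun x => taylorCoeff (G x) ν) S := by
  intro x hx
  have hr2 : 0 < r / 2 := by positivity
  have hsub : closedBall (0 : ℂ) (r / 2) ⊆ ball 0 r := closedBall_subset_ball (by linarith)
  rw [ContinuousWithinAt, Metric.tendsto_nhds]
  intro ε hε
  -- By compactness of the circle of radius `r / 2`, nearby parameters give uniformly close
  -- functions on it; Cauchy's inequality for the difference divides this closeness by `(r / 2) ^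
  -- ν`. The extra factor `1 / 2` makes the final inequality strict.
  have hε' : 0 < ε * (r / 2) ^ ν / 2 := by positivity
  obtain ⟨V, hV, hVp⟩ := (isCompact_sphere (0 : ℂ) (r / 2)).mem_uniformity_of_prod
    (hG.mono (prod_mono_right (sphere_subset_closedBall.trans hsub))) hx (dist_mem_uniformity hε')
  filter_upwards [hV, self_mem_nhdsWithin] with y hy hyS
  rw [dist_eq_norm, ← taylorCoeff_sub hr (hd y hyS) (hd x hx)]
  refine (norm_taylorCoeff_le hr2 (((hd y hyS).sub (hd x hx)).mono hsub)
    (C := ε * (r / 2) ^ ν / 2) (fun v hv => ?_) ν).trans_lt ?_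
  · have := hVp y hy v hv
    rw [mem_ofPred_eq, dist_eq_norm] at this
    exact this.le
  · rw [div_lt_iff₀ (by positivity)]
    linarith

/-- Holomorphy in one variable passes to limits in the parameters. -/
lemma differentiableOn_of_dense_parameters {X : Type*} [TopologicalSpace X] {S T : Set X}
    {G : X → ℂ → ℂ} {r : ℝ} (hG : ContinuousOn G.uncurry (S ×ˢ ball 0 r)) (hTS : T ⊆ S)
    (hd : ∀ x ∈ T, DifferentiableOn ℂ (G x) (ball 0 r)) {x : X} (hx : x ∈ S) (hxT : x ∈ closure T) :
    DifferentiableOn ℂ (G x) (ball 0 r) := by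
  have : (𝓝[T] x).NeBot := mem_closure_iff_nhdsWithin_neBot.1 hxT
  -- Joint continuity and compactness make the convergence uniform on compact sets, so Weierstrass'
  -- theorem applies.
  have hlim : TendstoLocallyUniformlyOn G (G x) (𝓝[T] x) (ball 0 r) := by
    rw [tendstoLocallyUniformlyOn_iff_forall_isCompact isOpen_ball]
    intro K hK hKc u hu
    obtain ⟨V, hV, hVp⟩ := hKc.mem_uniformity_of_prod (hG.mono (prod_mono_right hK)) hx
      (symm_le_uniformity hu)
    filter_upwards [nhdsWithin_mono x hTS hV] with y hy v hv
    exact hVp y hy v hv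
  exact hlim.differentiableOn (eventually_nhdsWithin_of_forall hd) isOpen_ball

/-- Integrals of holomorphic functions over a compact interval are holomorphic. -/
lemma differentiableOn_intervalIntegral {E : Type*} [NormedAddCommGroup E] [NormedSpace ℂ E]
    [ProperSpace E] {U : Set E} (hU : IsOpen U) {H : E → ℝ → ℂ}
    (hc : ContinuousOn H.uncurry (U ×ˢ univ))
    (hd : ∀ t, DifferentiableOn ℂ (fun z => H z t) U) (a b : ℝ) :
    DifferentiableOn ℂ (fun z => ∫ t in a..b, H z t) U := by
  intro z₀ hz₀
  -- The radius `2 * δ` leaves a `δ`-ball around every point of `ball z₀ δ`, on which the Cauchy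
  -- estimate bounds the derivative by `2 * B / δ`.
  obtain ⟨δ, hδ, hδU⟩ : ∃ δ > 0, closedBall z₀ (2 * δ) ⊆ U := by
    obtain ⟨δ, hδ, h⟩ := Metric.nhds_basis_closedBall.mem_iff.1 (hU.mem_nhds hz₀)
    exact ⟨δ / 2, half_pos hδ, by rwa [mul_div_cancel₀ _ two_ne_zero]⟩
  have hcont : ∀ z ∈ U, Continuous (H z) := fun z hz =>
    continuousOn_univ.1 (hc.comp (f := fun t : ℝ => (z, t)) (by fun_prop) fun t _ => ⟨hz, trivial⟩)
  have hb1 : ball z₀ δ ⊆ U := (ball_subset_closedBall.trans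
    (closedBall_subset_closedBall (by linarith))).trans hδU
  have hcb1 : closedBall z₀ δ ⊆ U := (closedBall_subset_closedBall (by linarith)).trans hδU
  obtain ⟨B, hB⟩ := ((isCompact_closedBall z₀ (2 * δ)).prod
    (isCompact_uIcc (a := a) (b := b))).exists_bound_of_continuousOn
    (hc.mono (prod_mono hδU (subset_univ _)))
  -- Differentiation under the integral needs the derivative to be measurable in `t`. It is even
  -- continuous: uniform closeness of `H · t` and `H · t₀` on a ball forces closeness of the
  -- derivatives at the centre.
  have hcd : Continuous fun t => fderiv ℂ (fun z => H z t) z₀ := by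
    rw [continuous_iff_continuousAt]
    intro t₀
    rw [ContinuousAt, Metric.tendsto_nhds]
    intro ε hε
    have hε' : 0 < ε * δ / 4 := by positivity
    obtain ⟨V, hV, hVp⟩ := (isCompact_closedBall z₀ δ).mem_uniformity_of_prod
      (f := fun t z => H z t) (s := univ) (q := t₀)
      (hc.comp (f := fun x : ℝ × E => (x.2, x.1)) (by fun_prop) fun x hx => ⟨hcb1 hx.2, trivial⟩)
      trivial (dist_mem_uniformity hε')
    rw [nhdsWithin_univ] at hV
    filter_upwards [hV] with t ht
    have hdt : ∀ s, DifferentiableAt ℂ (fun z => H z s) z₀ := fun s =>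
      (hd s).differentiableAt (hU.mem_nhds hz₀)
    rw [dist_eq_norm, ← fderiv_fun_sub (hdt t) (hdt t₀)]
    refine (Complex.norm_fderiv_le_div_of_mapsTo_ball
      (((hd t).sub (hd t₀)).mono hb1) (R₂ := ε * δ / 2) ?_ hδ).trans_lt ?_
    · intro z hz
      have h1 := hVp t ht z (ball_subset_closedBall hz)
      have h2 := hVp t ht z₀ (mem_closedBall_self hδ.le)
      simp only [mem_ofPred_eq, dist_eq_norm] at h1 h2
      rw [mem_closedBall, dist_eq_norm]
      refine (norm_sub_le _ _).trans ?_
      simp only [Pi.sub_apply]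
      linarith
    · rw [div_lt_iff₀ hδ]
      linarith [mul_pos hε hδ]
  -- Stated for a general `s` because an interval integral is a difference of integrals over two
  -- half-open intervals.
  have key : ∀ s : Set ℝ, s ⊆ uIcc a b → MeasurableSet s →
      DifferentiableAt ℂ (fun z => ∫ t in s, H z t) z₀ := by
    intro s hs hsm
    have hfin : MeasureTheory.IsFiniteMeasure (MeasureTheory.volume.restrict s) :=
      ⟨by
        rw [MeasureTheory.Measure.restrict_apply_univ]
        exact (MeasureTheory.measure_mono hs).trans_lt isCompact_uIcc.measure_lt_top⟩
    refine (hasFDerivAt_integral_of_dominated_of_fderiv_le (𝕜 := ℂ)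
      (F' := fun z t => fderiv ℂ (fun z => H z t) z) (bound := fun _ => (2 * B) / δ)
      (ball_mem_nhds z₀ hδ) ?_ ?_ hcd.aestronglyMeasurable ?_
      (MeasureTheory.integrable_const _) ?_).differentiableAt
    · filter_upwards [hU.mem_nhds hz₀] with z hz
      exact (hcont z hz).aestronglyMeasurable
    · exact (((hcont z₀ hz₀).continuousOn.integrableOn_compact isCompact_uIcc).mono_set hs)
    · refine (MeasureTheory.ae_restrict_iff' hsm).2 (Eventually.of_forall fun t ht z hz => ?_)
      have hzz : ball z δ ⊆ closedBall z₀ (2 * δ) := by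
        intro y hy
        rw [mem_ball] at hy hz
        rw [mem_closedBall]
        linarith [dist_triangle y z z₀]
      refine Complex.norm_fderiv_le_div_of_mapsTo_ball ((hd t).mono (hzz.trans hδU)) ?_ hδ
      intro y hy
      rw [mem_closedBall, dist_eq_norm]
      have h1 := hB (y, t) ⟨hzz hy, hs ht⟩
      have h2 := hB (z, t) ⟨hzz (mem_ball_self hδ), hs ht⟩
      simp only [Function.uncurry] at h1 h2
      refine (norm_sub_le _ _).trans ?_
      linarith
    · exact Eventually.of_forall fun t z hz =>
        ((hd t).differentiableAt (hU.mem_nhds (hb1 hz))).hasFDerivAt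
  unfold intervalIntegral
  refine DifferentiableAt.differentiableWithinAt (.sub (key _ ?_ measurableSet_Ioc)
    (key _ ?_ measurableSet_Ioc))
  · exact Ioc_subset_Icc_self.trans Icc_subset_uIcc
  · exact Ioc_subset_Icc_self.trans Icc_subset_uIcc'

/-- Taylor coefficients depend holomorphically on parameters. -/
lemma differentiableOn_taylorCoeff {E : Type*} [NormedAddCommGroup E] [NormedSpace ℂ E]
    [ProperSpace E] {U : Set E} (hU : IsOpen U) {G : E → ℂ → ℂ} {r : ℝ} (hr : 0 < r)
    (hG : DifferentiableOn ℂ G.uncurry (U ×ˢ ball 0 r)) (ν : ℕ) :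
    DifferentiableOn ℂ (fun z => taylorCoeff (G z) ν) U := by
  have hr2 : 0 < r / 2 := by positivity
  have hsub : closedBall (0 : ℂ) (r / 2) ⊆ ball 0 r := closedBall_subset_ball (by linarith)
  have hcm : ∀ t, circleMap 0 (r / 2) t ∈ ball (0 : ℂ) r := fun t =>
    hsub (circleMap_mem_closedBall _ hr2.le t)
  have hne : ∀ t, circleMap 0 (r / 2) t ≠ 0 := fun t => circleMap_ne_center hr2.ne'
  -- Cauchy's integral formula turns the Taylor coefficient into an integral over a fixed circle
  -- that depends holomorphically on `z`.
  have hint : DifferentiableOn ℂ (fun z => ∮ v in C(0, r / 2), (1 / (v - 0) ^ (ν + 1)) • G z v)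
      U := by
    unfold circleIntegral
    refine differentiableOn_intervalIntegral hU ?_ (fun t => ?_) _ _
    · refine ContinuousOn.smul (f := fun x : E × ℝ => deriv (circleMap 0 (r / 2)) x.2)
        ?_ (ContinuousOn.smul (f := fun x : E × ℝ => 1 / (circleMap 0 (r / 2) x.2 - 0) ^ (ν + 1))
          ?_ ?_)
      · simp only [deriv_circleMap]
        fun_prop
      · refine Continuous.continuousOn (Continuous.div continuous_const (by fun_prop) fun x => ?_)
        rw [sub_zero]
        exact pow_ne_zero _ (hne _)
      · exact hG.continuousOn.comp (f := fun x : E × ℝ => (x.1, circleMap 0 (r / 2) x.2))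
          (by fun_prop) fun x hx => ⟨hx.1, hcm _⟩
    · have h1 : DifferentiableOn ℂ (fun z => G z (circleMap 0 (r / 2) t)) U :=
        hG.comp (f := fun z : E => (z, circleMap 0 (r / 2) t)) (by fun_prop)
        fun z hz => ⟨hz, hcm _⟩
      exact (h1.const_smul (1 / (circleMap 0 (r / 2) t - 0) ^ (ν + 1))).const_smul
        (deriv (circleMap 0 (r / 2)) t)
  refine (hint.const_mul (2 * Real.pi * Complex.I)⁻¹).congr fun z hz => ?_
  have hGz : DifferentiableOn ℂ (G z) (ball 0 r) :=
    hG.comp (f := fun v : ℂ => (z, v)) (by fun_prop) fun v hv => ⟨hz, hv⟩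
  rw [DiffContOnCl.circleIntegral_one_div_sub_center_pow_smul hr2 ν
    ((hGz.mono hsub).diffContOnCl_ball subset_rfl), taylorCoeff, smul_eq_mul]
  have : (2 * Real.pi * Complex.I : ℂ) ≠ 0 := Complex.two_pi_I_ne_zero
  have : (ν.factorial : ℂ) ≠ 0 := by exact_mod_cast ν.factorial_ne_zero
  field_simp

end TaylorCoeff

/-! ### Topology of the logarithmic chart -/

section LogPlaneTopology

open Metric Set Filter Topology

namespace LogPlane

lemma isOpen_logDisk (r : ℝ) : IsOpen (logDisk r) :=
  ⟨isOpen_lt Complex.continuous_re continuous_const, fun _ => ⟨r, subset_rfl⟩⟩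

lemma negInf_mem_logDisk (r : ℝ) : negInf ∈ logDisk r := trivial

lemma isOpenEmbedding_fin : IsOpenEmbedding fin := by
  refine .of_continuous_injective_isOpenMap (continuous_def.2 fun U hU => hU.1)
    (fun _ _ h => fin.inj h) fun U hU => ⟨?_, ?_⟩
  · rwa [preimage_image_eq _ fun _ _ h => fin.inj h]
  · rintro ⟨z, _, h⟩
    cases h

lemma continuous_exp : Continuous exp := by
  refine continuous_def.2 fun V hV => ⟨hV.preimage Complex.continuous_exp, fun h => ?_⟩
  obtain ⟨ε, hε, hεV⟩ := Metric.isOpen_iff.1 hV 0 h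
  refine ⟨Real.log ε, fun w hw => hεV ?_⟩
  cases w with
  | negInf => exact mem_ball_self hε
  | fin z =>
    rw [mem_ball_zero_iff]
    change ‖Complex.exp z‖ < ε
    rw [Complex.norm_exp]
    exact (Real.lt_log_iff_exp_lt hε).1 hw

lemma continuous_translate : Continuous fun x : ℂ × LogPlane => x.2.translate x.1 := by
  rw [continuous_iff_continuousAt]
  rintro ⟨c, _ | z⟩
  · intro U hU
    obtain ⟨V, hVU, hVo, hV⟩ := mem_nhds_iff.1 hU
    obtain ⟨r, hr⟩ := hVo.2 hV
    -- A translation by `d` with `|d - c| < 1` raises real parts by less than `c.re + 1`.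
    have : ball c 1 ×ˢ logDisk (r - c.re - 1) ∈ 𝓝 (c, negInf) :=
      prod_mem_nhds (ball_mem_nhds c one_pos)
        ((isOpen_logDisk _).mem_nhds (negInf_mem_logDisk _))
    refine mem_map.2 ?_
    filter_upwards [this]
    rintro ⟨d, w⟩ ⟨hd, hw⟩
    refine hVU (hr ?_)
    cases w with
    | negInf => exact negInf_mem_logDisk _
    | fin y =>
      change (y + d).re < r
      have h1 : y.re < r - c.re - 1 := hw
      have h2 := (Complex.abs_re_le_norm (d - c)).trans_lt (mem_ball_iff_norm.1 hd)
      rw [Complex.sub_re] at h2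
      rw [Complex.add_re]
      linarith [le_abs_self (d.re - c.re)]
  · have h := (IsOpenEmbedding.id (X := ℂ)).prodMap isOpenEmbedding_fin
    refine (h.continuousAt_iff (x := (c, z))).1 ?_
    exact (isOpenEmbedding_fin.continuous.comp
      (continuous_snd.add continuous_fst)).continuousAt

lemma exp_translate (c : ℂ) (w : LogPlane) :
    (w.translate c).exp = w.exp * Complex.exp c := by
  cases w with
  | negInf => exact (zero_mul _).symm
  | fin z => exact Complex.exp_add z c

lemma abs_im_translate_le (c : ℂ) (w : LogPlane) : |(w.translate c).im| ≤ |w.im| + |c.im| := by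
  cases w with
  | negInf => simp [translate, im]
  | fin z => simpa [translate, im] using abs_add_le z.im c.im

/-- Finite approximations of the points of the logarithmic chart. -/
def finiteApprox (t : ℝ) : LogPlane → ℂ
  | negInf => -t
  | fin z => z

lemma im_finiteApprox (t : ℝ) (w : LogPlane) : (fin (finiteApprox t w)).im = w.im := by
  cases w with
  | negInf => simp [finiteApprox, im]
  | fin z => rfl

lemma tendsto_finiteApprox (w : LogPlane) :
    Tendsto (fun t : ℝ => fin (finiteApprox t w)) atTop (𝓝 w) := by
  cases w with
  | fin z => exact tendsto_const_nhds
  | negInf =>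
    intro U hU
    obtain ⟨V, hVU, hVo, hV⟩ := mem_nhds_iff.1 hU
    obtain ⟨r, hr⟩ := hVo.2 hV
    refine mem_map.2 ?_
    filter_upwards [eventually_gt_atTop (-r)] with t ht
    refine hVU (hr ?_)
    change (-(t : ℂ)).re < r
    rw [Complex.neg_re, Complex.ofReal_re]
    linarith

end LogPlane

namespace MultiParam

variable {m : ℕ} (τ : MultiParam m)

lemma S_subset_SP (p : ℕ) : τ.S ⊆ τ.SP p := fun _ hw => ⟨hw.1, fun k hk => Or.inl (hw.2 k hk)⟩

lemma isOpen_disk : IsOpen τ.disk := by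
  simp only [disk, ofPred_forall]
  exact isOpen_iInter_of_finite fun i => isOpen_lt (by fun_prop) continuous_const

lemma isOpen_inDisk (k : Fin m → ℝ≥0) (p : ℕ) : IsOpen {z | τ.InDisk k p z} := by
  unfold InDisk
  by_cases hk : k = 0
  · simp [hk]
  · simp only [hk, false_or]
    refine isOpen_lt (continuous_finsetProd _ fun i _ => ?_) continuous_const
    exact Continuous.rpow_const (by fun_prop) fun _ => Or.inr (k i).2

lemma isOpen_finite_SP (p : ℕ) :
    IsOpen {z : Fin m → ℂ | (fun i => LogPlane.fin (z i)) ∈ τ.SP p} := by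
  have hexp : Continuous fun (z : Fin m → ℂ) (i : Fin m) => (LogPlane.fin (z i)).exp :=
    continuous_pi fun i => Complex.continuous_exp.comp (continuous_apply i)
  have h2 : IsOpen (⋂ k ∈ τ.K, {z : Fin m → ℂ | τ.InSector k (fun i => LogPlane.fin (z i)) ∨
      τ.InDisk k p fun i => (LogPlane.fin (z i)).exp}) := by
    refine τ.K_finite.isOpen_biInter fun k _ => ?_
    have h : Continuous fun z : Fin m → ℂ => ∑ i, (k i : ℝ) * |(LogPlane.fin (z i)).im| := by
      simp only [LogPlane.im]
      fun_prop
    exact (isOpen_lt h continuous_const).union ((τ.isOpen_inDisk k p).preimage hexp)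
  convert (τ.isOpen_disk.preimage hexp).inter h2 using 1
  ext z
  simp [SP]

/-- Replacing each entry `-∞` by `-t` keeps all imaginary parts, hence the sector conditions, and
the disk conditions are open, so they hold for large `t`. Needed because log-holomorphy gives
differentiability at finite points only. -/
lemma SP_subset_closure_finite (p : ℕ) :
    τ.SP p ⊆ closure {w | w ∈ τ.SP p ∧ ∃ z : Fin m → ℂ, w = fun i => LogPlane.fin (z i)} := by
  intro w hw
  have hlim : Tendsto (fun (t : ℝ) i => LogPlane.fin ((w i).finiteApprox t)) atTop (𝓝 w) :=
    tendsto_pi_nhds.2 fun i => (w i).tendsto_finiteApprox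
  have hexp : Tendsto (fun (t : ℝ) i => (LogPlane.fin ((w i).finiteApprox t)).exp) atTop
      (𝓝 fun i => (w i).exp) :=
    tendsto_pi_nhds.2 fun i =>
      (LogPlane.continuous_exp.tendsto (w i)).comp (w i).tendsto_finiteApprox
  refine mem_closure_of_tendsto hlim ?_
  have h1 := hexp.eventually (τ.isOpen_disk.mem_nhds hw.1)
  have h2 : ∀ᶠ t : ℝ in atTop, ∀ k ∈ τ.K,
      τ.InSector k (fun i => LogPlane.fin ((w i).finiteApprox t)) ∨
        τ.InDisk k p fun i => (LogPlane.fin ((w i).finiteApprox t)).exp := by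
    refine (eventually_all_finite τ.K_finite).2 fun k hk => ?_
    rcases hw.2 k hk with h | h
    · refine Eventually.of_forall fun t => Or.inl ?_
      simpa only [InSector, LogPlane.im_finiteApprox] using h
    · exact (hexp.eventually ((τ.isOpen_inDisk k p).mem_nhds h)).mono fun t ht => Or.inr ht
  filter_upwards [h1, h2] with t ht1 ht2
  exact ⟨⟨ht1, ht2⟩, _, rfl⟩

end MultiParam

end LogPlaneTopology

/-! ### Geometry of blow-ups -/

section BlowUpGeometry

open Metric Set Filter Topology

variable {M : ℕ} (i : Fin (M + 1)) (j : Fin M)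

/-- No entries cancel in `[0, ∞)`. This matches the exemption of `k = 0` from the disk conditions
for `K` and `K'`. -/
lemma collapse_eq_zero_iff {k : Fin (M + 1) → ℝ≥0} : collapse i j k = 0 ↔ k = 0 := by
  constructor
  · intro h
    funext b
    rcases Fin.eq_self_or_eq_succAbove i b with rfl | ⟨a, rfl⟩
    · have := congrFun h j
      simp only [collapse, if_true, Pi.zero_apply, add_eq_zero] at this
      exact this.2
    · have := congrFun h a
      simp only [collapse, Pi.zero_apply, add_eq_zero] at this
      exact this.1
  · rintro rfl
    funext a
    simp [collapse]

/-- The monomial form of the substitution `X_i = X'_j c`, used for absolute values, radii and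
polyradii alike. Exponents are nonnegative, so vanishing `x a` do no harm. -/
lemma prod_insertNth_rpow {x : Fin M → ℝ} (hx : ∀ a, 0 ≤ x a) {c : ℝ} (hc : 0 ≤ c)
    (k : Fin (M + 1) → ℝ≥0) :
    ∏ b, (i.insertNth (x j * c) x : Fin (M + 1) → ℝ) b ^ (k b : ℝ) =
      c ^ (k i : ℝ) * ∏ a, x a ^ (collapse i j k a : ℝ) := by
  have h : ∀ a, x a ^ (collapse i j k a : ℝ) =
      x a ^ (k (i.succAbove a) : ℝ) * if a = j then x a ^ (k i : ℝ) else 1 := by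
    intro a
    unfold collapse
    split_ifs
    · rw [NNReal.coe_add, Real.rpow_add_of_nonneg (hx a) (k (i.succAbove a)).coe_nonneg
        (k i).coe_nonneg]
    · rw [add_zero, mul_one]
  rw [Fin.prod_univ_succAbove _ i]
  simp only [Fin.insertNth_apply_same, Fin.insertNth_apply_succAbove, h, Finset.prod_mul_distrib,
    Finset.prod_ite_eq', Finset.mem_univ, if_true, Real.mul_rpow (hx j) hc]
  ring

lemma one_le_blowUpExponent (τ : MultiParam (M + 1)) : 1 ≤ blowUpExponent i τ :=
  le_csSup ((τ.K_finite.image _).insert 1).bddAbove (mem_insert _ _)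

lemma blowUpRadius_le (lam ρ₀ : ℝ) (τ : MultiParam (M + 1)) (a : Fin M) :
    blowUpRadius i j lam ρ₀ τ a ≤ τ.R (i.succAbove a) := by
  unfold blowUpRadius
  split_ifs with h
  · exact h ▸ min_le_left _ _
  · exact le_rfl

/-- If `lam + 2ρ₀ ≥ 1`, the third entry of the minimum suffices because the exponent is at least
`1`; otherwise the second entry does. Every later use of the definition of `R'_j` passes through
this bound and `R'_j ≤ R_(i.succAbove j)`. -/
lemma blowUpRadius_mul_le {lam ρ₀ : ℝ} (hlam : 0 < lam) (hρ₀ : 0 < ρ₀) (τ : MultiParam (M + 1)) :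
    blowUpRadius i j lam ρ₀ τ j * (lam + 2 * ρ₀) ≤ τ.R i := by
  have hc : 0 < lam + 2 * ρ₀ := by positivity
  have hR := τ.R_pos i
  simp only [blowUpRadius, if_true]
  rcases le_total 1 (lam + 2 * ρ₀) with h | h
  · calc _ ≤ (τ.R i / (lam + 2 * ρ₀) ^ blowUpExponent i τ) * (lam + 2 * ρ₀) := by
          gcongr
          exact (min_le_right _ _).trans (min_le_right _ _)
      _ ≤ (τ.R i / (lam + 2 * ρ₀)) * (lam + 2 * ρ₀) := by
          gcongr
          exact Real.self_le_rpow_of_one_le h (one_le_blowUpExponent i τ)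
      _ = τ.R i := div_mul_cancel₀ _ hc.ne'
  · calc _ ≤ τ.R i * 1 := by
          gcongr
          exact (min_le_right _ _).trans (min_le_left _ _)
      _ = τ.R i := mul_one _

section

variable {lam ρ₀ θ' : ℝ} (hlam : 0 < lam) (hρ₀ : 0 < ρ₀) (hθ' : Real.pi / 2 < θ')
  (τ : MultiParam (M + 1))

lemma insertNth_mem_disk {z : Fin M → ℂ} (hz : z ∈ (τ.blowUp i j lam ρ₀ θ' hlam hρ₀ hθ').disk)
    {c : ℂ} (hc : ‖c‖ ≤ lam + 2 * ρ₀) : i.insertNth (z j * c) z ∈ τ.disk := by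
  have hz' : ∀ a, ‖z a‖ < blowUpRadius i j lam ρ₀ τ a := hz
  intro b
  rcases Fin.eq_self_or_eq_succAbove i b with rfl | ⟨a, rfl⟩
  · rw [Fin.insertNth_apply_same, norm_mul]
    have hpos : 0 < lam + 2 * ρ₀ := by positivity
    refine lt_of_lt_of_le ?_ (blowUpRadius_mul_le b j hlam hρ₀ τ)
    calc _ ≤ ‖z j‖ * (lam + 2 * ρ₀) := by gcongr
      _ < _ := by gcongr; exact hz' j
  · rw [Fin.insertNth_apply_succAbove]
    exact (hz' a).trans_le (blowUpRadius_le i j lam ρ₀ τ a)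

/-- The factor `|c|^(k i)` is put back into the radius: `R'_j (lam + 2ρ₀) ≤ R_i` and the other radii
do not grow, so the bound `1 / (1 + p)` survives with the same `p`. -/
lemma insertNth_inDisk {k : Fin (M + 1) → ℝ≥0} {p : ℕ} {z : Fin M → ℂ}
    (hz : (τ.blowUp i j lam ρ₀ θ' hlam hρ₀ hθ').InDisk (collapse i j k) p z)
    {c : ℂ} (hc : ‖c‖ ≤ lam + 2 * ρ₀) : τ.InDisk k p (i.insertNth (z j * c) z) := by
  rcases hz with hz | hz
  · exact Or.inl ((collapse_eq_zero_iff i j).1 hz)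
  refine Or.inr ?_
  have hz' : ∏ a, ‖z a‖ ^ (collapse i j k a : ℝ) <
    (∏ a, blowUpRadius i j lam ρ₀ τ a ^ (collapse i j k a : ℝ)) / (1 + p) := hz
  have hpos : 0 < lam + 2 * ρ₀ := by positivity
  have hR' : ∀ a, 0 < blowUpRadius i j lam ρ₀ τ a := (τ.blowUp i j lam ρ₀ θ' hlam hρ₀ hθ').R_pos
  have hnorm : (fun b => ‖(i.insertNth (z j * c) z : Fin (M + 1) → ℂ) b‖) =
      (i.insertNth (‖z j‖ * ‖c‖) fun a => ‖z a‖ : Fin (M + 1) → ℝ) := by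
    funext b
    rcases Fin.eq_self_or_eq_succAbove i b with rfl | ⟨a, rfl⟩ <;> simp
  have h1 : ∏ b, ‖(i.insertNth (z j * c) z : Fin (M + 1) → ℂ) b‖ ^ (k b : ℝ) =
      ‖c‖ ^ (k i : ℝ) * ∏ a, ‖z a‖ ^ (collapse i j k a : ℝ) := by
    rw [← prod_insertNth_rpow i j (fun a => norm_nonneg (z a)) (norm_nonneg c) k, ← hnorm]
  rw [h1]
  calc _ ≤ (lam + 2 * ρ₀) ^ (k i : ℝ) * ∏ a, ‖z a‖ ^ (collapse i j k a : ℝ) := by gcongr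
    _ < (lam + 2 * ρ₀) ^ (k i : ℝ) *
        ((∏ a, blowUpRadius i j lam ρ₀ τ a ^ (collapse i j k a : ℝ)) / (1 + p)) := by gcongr
    _ = (∏ b, (i.insertNth (blowUpRadius i j lam ρ₀ τ j * (lam + 2 * ρ₀))
          (blowUpRadius i j lam ρ₀ τ) : Fin (M + 1) → ℝ) b ^ (k b : ℝ)) / (1 + p) := by
        rw [prod_insertNth_rpow i j (fun a => (hR' a).le) hpos.le k, mul_div_assoc]
    _ ≤ (∏ b, τ.R b ^ (k b : ℝ)) / (1 + p) := by
        have hins : ∀ b, 0 ≤ (i.insertNth (blowUpRadius i j lam ρ₀ τ j * (lam + 2 * ρ₀))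
            (blowUpRadius i j lam ρ₀ τ) : Fin (M + 1) → ℝ) b ∧
            (i.insertNth (blowUpRadius i j lam ρ₀ τ j * (lam + 2 * ρ₀))
            (blowUpRadius i j lam ρ₀ τ) : Fin (M + 1) → ℝ) b ≤ τ.R b := by
          intro b
          rcases Fin.eq_self_or_eq_succAbove i b with rfl | ⟨a, rfl⟩
          · rw [Fin.insertNth_apply_same]
            exact ⟨(mul_pos (hR' j) hpos).le, blowUpRadius_mul_le b j hlam hρ₀ τ⟩
          · rw [Fin.insertNth_apply_succAbove]
            exact ⟨(hR' a).le, blowUpRadius_le i j lam ρ₀ τ a⟩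
        gcongr with b
        · exact fun b _ => Real.rpow_nonneg (hins b).1 _
        · exact (hins b).1
        · exact (hins b).2

lemma insertNth_mem_diskP {p : ℕ} {z : Fin M → ℂ}
    (hz : z ∈ (τ.blowUp i j lam ρ₀ θ' hlam hρ₀ hθ').diskP p)
    {c : ℂ} (hc : ‖c‖ ≤ lam + 2 * ρ₀) : i.insertNth (z j * c) z ∈ τ.diskP p :=
  ⟨insertNth_mem_disk i j hlam hρ₀ hθ' τ hz.1 hc, fun _ hk =>
    insertNth_inDisk i j hlam hρ₀ hθ' τ (hz.2 _ (mem_image_of_mem _ hk)) hc⟩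

end

/-- The first component of the blow-up map. -/
noncomputable def blowUpPoint (lam : ℝ) (w : Fin M → LogPlane) (v : ℂ) : Fin (M + 1) → LogPlane :=
  i.insertNth ((w j).translate (Complex.log (lam + v))) w

lemma lam_add_ne_zero {lam : ℝ} {v : ℂ} (hv : ‖v‖ < lam) : (lam : ℂ) + v ≠ 0 := by
  intro h
  have : v = -(lam : ℂ) := by linear_combination h
  rw [this, norm_neg, Complex.norm_real] at hv
  exact absurd hv (not_lt.2 (le_abs_self lam))

lemma lam_add_mem_slitPlane {lam : ℝ} {v : ℂ} (hv : ‖v‖ < lam) :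
    (lam : ℂ) + v ∈ Complex.slitPlane := by
  left
  rw [Complex.add_re, Complex.ofReal_re]
  linarith [neg_abs_le v.re, Complex.abs_re_le_norm v]

lemma norm_lam_add_le {lam : ℝ} (hlam : 0 < lam) {v : ℂ} {C : ℝ} (hv : ‖v‖ ≤ C) :
    ‖(lam : ℂ) + v‖ ≤ lam + C :=
  (norm_add_le _ _).trans (by rw [Complex.norm_real, Real.norm_of_nonneg hlam.le]; gcongr)

lemma exp_blowUpPoint {lam : ℝ} (w : Fin M → LogPlane) {v : ℂ} (hv : ‖v‖ < lam) :
    (fun b => (blowUpPoint i j lam w v b).exp) =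
      i.insertNth ((w j).exp * (lam + v)) fun a => (w a).exp := by
  funext b
  rcases Fin.eq_self_or_eq_succAbove i b with rfl | ⟨a, rfl⟩
  · simp [blowUpPoint, LogPlane.exp_translate, Complex.exp_log (lam_add_ne_zero hv)]
  · simp [blowUpPoint]

/-- The triangle inequality in the entry `i`, since `Im log (lam + v)` is the argument; only an
inequality, as `-∞` absorbs the translation. -/
lemma inSector_sum_blowUpPoint_le (k : Fin (M + 1) → ℝ≥0) (lam : ℝ) (w : Fin M → LogPlane) (v : ℂ) :
    ∑ b, (k b : ℝ) * |(blowUpPoint i j lam w v b).im| ≤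
      ∑ a, (collapse i j k a : ℝ) * |(w a).im| + k i * |Complex.arg (lam + v)| := by
  have h : ∀ a, (collapse i j k a : ℝ) * |(w a).im| = (k (i.succAbove a) : ℝ) * |(w a).im| +
      if a = j then (k i : ℝ) * |(w a).im| else 0 := by
    intro a
    unfold collapse
    split_ifs
    · rw [NNReal.coe_add, add_mul]
    · rw [add_zero, add_zero]
  rw [Fin.sum_univ_succAbove _ i]
  simp only [blowUpPoint, Fin.insertNth_apply_same, Fin.insertNth_apply_succAbove, h,
    Finset.sum_add_distrib, Finset.sum_ite_eq', Finset.mem_univ, if_true]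
  have := LogPlane.abs_im_translate_le (Complex.log (lam + v)) (w j)
  rw [Complex.log_im] at this
  nlinarith [mul_le_mul_of_nonneg_left this (k i).2]

section

variable {lam ρ₀ θ' : ℝ} (hlam : 0 < lam) (hρ₀ : 0 < ρ₀) (hθ' : Real.pi / 2 < θ')
  (hρ₀_lt : 2 * ρ₀ < lam) (τ : MultiParam (M + 1))
  (harg : ∀ k ∈ τ.K, ∀ v : ℂ, ‖v‖ < 2 * ρ₀ → (k i : ℝ) * |Complex.arg (lam + v)| < τ.θ - θ')

include harg in
lemma inSector_blowUpPoint {k : Fin (M + 1) → ℝ≥0} (hk : k ∈ τ.K) {w : Fin M → LogPlane}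
    (hw : (τ.blowUp i j lam ρ₀ θ' hlam hρ₀ hθ').InSector (collapse i j k) w) {v : ℂ}
    (hv : ‖v‖ < 2 * ρ₀) : τ.InSector k (blowUpPoint i j lam w v) := by
  have hw' : ∑ a, (collapse i j k a : ℝ) * |(w a).im| < θ' := hw
  have := inSector_sum_blowUpPoint_le i j k lam w v
  have := harg k hk v hv
  unfold MultiParam.InSector
  linarith

include hρ₀_lt in
lemma exp_blowUpPoint_mem_disk {w : Fin M → LogPlane}
    (hw : (fun a => (w a).exp) ∈ (τ.blowUp i j lam ρ₀ θ' hlam hρ₀ hθ').disk) {v : ℂ}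
    (hv : ‖v‖ < 2 * ρ₀) : (fun b => (blowUpPoint i j lam w v b).exp) ∈ τ.disk := by
  rw [exp_blowUpPoint i j w (hv.trans hρ₀_lt)]
  exact insertNth_mem_disk i j hlam hρ₀ hθ' τ hw (norm_lam_add_le hlam hv.le)

include hρ₀_lt harg in
lemma blowUpPoint_mem_S {w : Fin M → LogPlane} (hw : w ∈ (τ.blowUp i j lam ρ₀ θ' hlam hρ₀ hθ').S)
    {v : ℂ} (hv : ‖v‖ < 2 * ρ₀) : blowUpPoint i j lam w v ∈ τ.S :=
  ⟨exp_blowUpPoint_mem_disk i j hlam hρ₀ hθ' hρ₀_lt τ hw.1 hv, fun _ hk =>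
    inSector_blowUpPoint i j hlam hρ₀ hθ' τ harg hk (hw.2 _ (mem_image_of_mem _ hk)) hv⟩

include hρ₀_lt in
lemma blowUpPoint_mem_logDiskP {p : ℕ} {w : Fin M → LogPlane}
    (hw : w ∈ (τ.blowUp i j lam ρ₀ θ' hlam hρ₀ hθ').logDiskP p)
    {v : ℂ} (hv : ‖v‖ < 2 * ρ₀) : blowUpPoint i j lam w v ∈ τ.logDiskP p := by
  change (fun b => (blowUpPoint i j lam w v b).exp) ∈ τ.diskP p
  rw [exp_blowUpPoint i j w (hv.trans hρ₀_lt)]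
  exact insertNth_mem_diskP i j hlam hρ₀ hθ' τ hw (norm_lam_add_le hlam hv.le)

include hρ₀_lt harg in
-- For each `k` the alternative that holds downstairs, sector or disk, transfers to the same
-- alternative upstairs.
lemma blowUpPoint_mem_SP {p : ℕ} {w : Fin M → LogPlane}
    (hw : w ∈ (τ.blowUp i j lam ρ₀ θ' hlam hρ₀ hθ').SP p)
    {v : ℂ} (hv : ‖v‖ < 2 * ρ₀) : blowUpPoint i j lam w v ∈ τ.SP p := by
  refine ⟨exp_blowUpPoint_mem_disk i j hlam hρ₀ hθ' hρ₀_lt τ hw.1 hv, fun k hk => ?_⟩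
  rcases hw.2 _ (mem_image_of_mem _ hk) with h | h
  · exact Or.inl (inSector_blowUpPoint i j hlam hρ₀ hθ' τ harg hk h hv)
  · refine Or.inr ?_
    rw [exp_blowUpPoint i j w (hv.trans hρ₀_lt)]
    exact insertNth_inDisk i j hlam hρ₀ hθ' τ h (norm_lam_add_le hlam hv.le)

end

lemma continuousOn_blowUpPoint (lam : ℝ) :
    ContinuousOn (fun x : (Fin M → LogPlane) × ℂ => blowUpPoint i j lam x.1 x.2)
      (univ ×ˢ ball 0 lam) := by
  have hlog : ContinuousOn (fun x : (Fin M → LogPlane) × ℂ => Complex.log (lam + x.2))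
      (univ ×ˢ ball 0 lam) :=
    ContinuousOn.clog (by fun_prop) fun x hx =>
      lam_add_mem_slitPlane (mem_ball_zero_iff.1 hx.2)
  refine continuousOn_pi.2 fun b => ?_
  rcases Fin.eq_self_or_eq_succAbove i b with rfl | ⟨a, rfl⟩
  · simp only [blowUpPoint, Fin.insertNth_apply_same]
    exact LogPlane.continuous_translate.comp_continuousOn (hlog.prodMk (by fun_prop))
  · simp only [blowUpPoint, Fin.insertNth_apply_succAbove]
    fun_prop

/-- The blow-up map in finite coordinates. -/
noncomputable def blowUpFinite (lam : ℝ) (z : Fin M → ℂ) (v : ℂ) : Fin (M + 1) → ℂ :=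
  i.insertNth (z j + Complex.log (lam + v)) z

lemma blowUpPoint_fin (lam : ℝ) (z : Fin M → ℂ) (v : ℂ) :
    blowUpPoint i j lam (fun a => LogPlane.fin (z a)) v =
      fun b => LogPlane.fin (blowUpFinite i j lam z v b) := by
  funext b
  rcases Fin.eq_self_or_eq_succAbove i b with rfl | ⟨a, rfl⟩
  · simp [blowUpPoint, blowUpFinite, LogPlane.translate]
  · simp [blowUpPoint, blowUpFinite]

lemma differentiableOn_blowUpFinite (lam : ℝ) :
    DifferentiableOn ℂ (fun x : (Fin M → ℂ) × ℂ => blowUpFinite i j lam x.1 x.2)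
      (univ ×ˢ ball 0 lam) := by
  have hlog : DifferentiableOn ℂ (fun x : (Fin M → ℂ) × ℂ => Complex.log (lam + x.2))
      (univ ×ˢ ball 0 lam) :=
    DifferentiableOn.clog (by fun_prop) fun x hx =>
      lam_add_mem_slitPlane (mem_ball_zero_iff.1 hx.2)
  refine differentiableOn_pi.2 fun b => ?_
  rcases Fin.eq_self_or_eq_succAbove i b with rfl | ⟨a, rfl⟩
  · simp only [blowUpFinite, Fin.insertNth_apply_same]
    exact DifferentiableOn.add (by fun_prop) hlog
  · simp only [blowUpFinite, Fin.insertNth_apply_succAbove]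
    fun_prop

end BlowUpGeometry

/-! ### Blow-ups of generalized power series -/

section BlowUpSeries

open Metric Set Filter Topology

/-- The coefficient of `v ^ ν` in the binomial series of `(lam + v) ^ a`. -/
noncomputable def blowUpWeight (lam a : ℝ) (ν : ℕ) : ℂ :=
  ((Ring.choose a ν * lam ^ (a - ν) : ℝ) : ℂ)

lemma hasSum_blowUpWeight {lam : ℝ} (hlam : 0 < lam) (a : ℝ) {v : ℂ} (hv : ‖v‖ < lam) :
    HasSum (fun ν => blowUpWeight lam a ν * v ^ ν) (((lam : ℂ) + v) ^ (a : ℂ)) := by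
  have hl : (lam : ℂ) ≠ 0 := by exact_mod_cast hlam.ne'
  have hy : v / lam ∈ Metric.eball (0 : ℂ) 1 := by
    rw [← ENNReal.coe_one, Metric.eball_coe, mem_ball_zero_iff, norm_div, Complex.norm_real,
      Real.norm_of_nonneg hlam.le, NNReal.coe_one, div_lt_one hlam]
    exact hv
  have h := ((Complex.one_add_cpow_hasFPowerSeriesOnBall_zero (a := (a : ℂ))).hasSum hy).mul_left
    ((lam : ℂ) ^ (a : ℂ))
  have hne : 1 + v / (lam : ℂ) ≠ 0 := by
    intro h0
    refine lam_add_ne_zero hv ?_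
    field_simp at h0
    rwa [mul_zero] at h0
  -- The principal power is multiplicative here because `lam` is a positive real.
  have hval : ((lam : ℂ) + v) ^ (a : ℂ) = (lam : ℂ) ^ (a : ℂ) * (1 + v / lam) ^ (a : ℂ) := by
    have h1 : (lam : ℂ) + v = lam * (1 + v / lam) := by field_simp
    rw [h1, Complex.cpow_def_of_ne_zero (mul_ne_zero hl hne), Complex.log_ofReal_mul hlam hne,
      Complex.cpow_def_of_ne_zero hl, Complex.cpow_def_of_ne_zero hne, ← Complex.exp_add,
      Complex.ofReal_log hlam.le]
    ring_nf
  rw [hval]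
  rw [zero_add] at h
  refine h.congr_fun fun ν => ?_
  have hc : Ring.choose (a : ℂ) ν = ((Ring.choose a ν : ℝ) : ℂ) :=
    (Ring.map_choose Complex.ofRealHom a ν).symm
  have hp : ((lam ^ (a - ν) : ℝ) : ℂ) = (lam : ℂ) ^ (a : ℂ) / (lam : ℂ) ^ ν := by
    rw [Real.rpow_sub hlam, Real.rpow_natCast, Complex.ofReal_div, Complex.ofReal_pow,
      Complex.ofReal_cpow hlam.le]
  rw [binomialSeries_apply, List.ofFn_const, List.prod_replicate, hc, blowUpWeight,
    Complex.ofReal_mul, hp, smul_eq_mul, div_pow]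
  ring

/-- Cauchy's inequality for `(lam + v)^a` on `|v| = r`, where the modulus is at most `(lam + r)^a`
as `a ≥ 0`. The bound has the shape of a monomial evaluated at a larger radius, so it can be summed
over exponents. -/
lemma norm_blowUpWeight_mul_le {lam r a : ℝ} (hr : 0 < r) (hlam : r < lam) (ha : 0 ≤ a) (ν : ℕ) :
    ‖blowUpWeight lam a ν‖ * r ^ ν ≤ (lam + r) ^ a := by
  have hl : 0 < lam := hr.trans hlam
  rw [← le_div_iff₀ (by positivity), ← taylorCoeff_eq_of_hasSum hl
    (φ := fun v => ((lam : ℂ) + v) ^ (a : ℂ)) (fun v hv => hasSum_blowUpWeight hl a hv) ν]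
  refine norm_taylorCoeff_le hr ?_ (fun v hv => ?_) ν
  · refine DifferentiableOn.cpow (by fun_prop) (by fun_prop) fun v hv => ?_
    exact lam_add_mem_slitPlane ((mem_closedBall_zero_iff.1 hv).trans_lt hlam)
  · rw [Complex.norm_cpow_real]
    exact Real.rpow_le_rpow (norm_nonneg _)
      (norm_lam_add_le hl (mem_sphere_zero_iff_norm.1 hv).le) ha

namespace LogPlane

lemma expMul_add (a b : ℝ≥0) (w : LogPlane) : w.expMul (a + b) = w.expMul a * w.expMul b := by
  cases w with
  | negInf =>
    by_cases ha : a = 0 <;> by_cases hb : b = 0 <;> simp [expMul, ha, hb]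
  | fin z =>
    simp only [expMul, NNReal.coe_add, Complex.ofReal_add, add_mul, Complex.exp_add]

lemma expMul_translate_log (a : ℝ≥0) (w : LogPlane) {x : ℂ} (hx : x ≠ 0) :
    (w.translate (Complex.log x)).expMul a = w.expMul a * x ^ ((a : ℝ) : ℂ) := by
  cases w with
  | negInf =>
    by_cases ha : a = 0 <;> simp [expMul, translate, ha]
  | fin z =>
    simp only [expMul, translate, Complex.cpow_def_of_ne_zero hx, ← Complex.exp_add]
    ring_nf

end LogPlane

variable {M : ℕ} (i : Fin (M + 1)) (j : Fin M)

lemma prod_expMul_blowUpPoint {lam : ℝ} (w : Fin M → LogPlane) {v : ℂ} (hv : ‖v‖ < lam)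
    (α : Fin (M + 1) → ℝ≥0) :
    ∏ b, (blowUpPoint i j lam w v b).expMul (α b) =
      (∏ a, (w a).expMul (collapse i j α a)) * ((lam : ℂ) + v) ^ ((α i : ℝ) : ℂ) := by
  have h : ∀ a, (w a).expMul (collapse i j α a) = (w a).expMul (α (i.succAbove a)) *
      if a = j then (w a).expMul (α i) else 1 := by
    intro a
    unfold collapse
    split_ifs
    · rw [LogPlane.expMul_add]
    · rw [add_zero, mul_one]
  rw [Fin.prod_univ_succAbove _ i]
  simp only [blowUpPoint, Fin.insertNth_apply_same, Fin.insertNth_apply_succAbove, h,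
    Finset.prod_mul_distrib, Finset.prod_ite_eq', Finset.mem_univ, if_true,
    LogPlane.expMul_translate_log _ _ (lam_add_ne_zero hv)]
  ring

namespace GenSeries

/-- The finite sum in the definition is recast as a sum over a fibre of `collapse`, the form in
which sums over all `α` decompose. -/
lemma hasSum_coeff_blowUpCoeff (lam : ℝ) (F : GenSeries (M + 1)) (ν : ℕ) (γ : Fin M → ℝ≥0) :
    HasSum (fun α : {α : Fin (M + 1) → ℝ≥0 // collapse i j α = γ} =>
      F.coeff α * blowUpWeight lam (α.1 i) ν) ((F.blowUpCoeff i j lam ν).coeff γ) := by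
  have hfin : (Function.support fun α : {α : Fin (M + 1) → ℝ≥0 // collapse i j α = γ} =>
      F.coeff α * blowUpWeight lam (α.1 i) ν).Finite := by
    refine ((finite_collapse_fiber i j F γ).preimage
      (Subtype.val_injective.injOn)).subset fun α hα => ⟨?_, α.2⟩
    exact left_ne_zero_of_mul hα
  have h := (summable_of_hasFiniteSupport (L := .unconditional _) hfin).hasSum
  rw [tsum_eq_finsum hfin] at h
  have hs := finsum_subtype_eq_finsum_cond (fun α => collapse i j α = γ)
    (f := fun α => F.coeff α * blowUpWeight lam (α i) ν)
  rw [hs] at h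
  exact h

lemma blowUpCoeff_support_subset (lam : ℝ) {F : GenSeries (M + 1)} {Δ : Set (Fin (M + 1) → ℝ≥0)}
    (hF : F.support ⊆ Δ) (ν : ℕ) : (F.blowUpCoeff i j lam ν).support ⊆ collapse i j '' Δ := by
  intro γ hγ
  obtain ⟨α, hα⟩ := exists_ne_zero_of_finsum_mem_ne_zero hγ
  exact ⟨α, hF (left_ne_zero_of_mul hα.2), hα.1⟩

/-- The Taylor coefficients of a log-sum along a blow-up are log-sums. -/
lemma hasLogSumAt_blowUpCoeff {lam r : ℝ} (hr : 0 < r) (hlam : r < lam) {F : GenSeries (M + 1)}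
    {w : Fin M → LogPlane} {φ : ℂ → ℂ}
    (h : ∀ v : ℂ, ‖v‖ ≤ r → F.HasLogSumAt (blowUpPoint i j lam w v) (φ v)) (ν : ℕ) :
    (F.blowUpCoeff i j lam ν).HasLogSumAt w (taylorCoeff φ ν) := by
  have hl : 0 < lam := hr.trans hlam
  set P : (Fin (M + 1) → ℝ≥0) → ℂ := fun α =>
    F.coeff α * ∏ a, (w a).expMul (collapse i j α a) with hP
  have hφ : ∀ v : ℂ, ‖v‖ ≤ r →
      HasSum (fun α => P α * ((lam : ℂ) + v) ^ ((α i : ℝ) : ℂ)) (φ v) := by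
    intro v hv
    refine (h v hv).congr_fun fun α => ?_
    rw [prod_expMul_blowUpPoint i j w (hv.trans_lt hlam) α, hP, mul_assoc]
  -- At the point `v = r` the terms of the log-sum have exactly these absolute values; this is why
  -- `h` includes `‖v‖ = r`.
  have hb : Summable fun α => ‖P α‖ * (lam + r) ^ (α i : ℝ) := by
    refine (hφ (r : ℂ) ?_).summable.norm.congr fun α => ?_
    · rw [Complex.norm_real, Real.norm_of_nonneg hr.le]
    · rw [norm_mul, Complex.norm_cpow_real, ← Complex.ofReal_add, Complex.norm_real,
        Real.norm_of_nonneg (by positivity)]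
  have hT := (hasSum_rearrange hr (c := fun α ν => P α * blowUpWeight lam (α i) ν) hb
    (fun α ν => by
      rw [norm_mul, mul_assoc]
      gcongr
      exact norm_blowUpWeight_mul_le hr hlam (α i).coe_nonneg ν)
    (fun α v hv => by
      refine ((hasSum_blowUpWeight hl (α i : ℝ) (hv.trans hlam)).mul_left (P α)).congr_fun
        fun ν => ?_
      ring)
    (fun v hv => hφ v hv.le)).1 ν
  -- Grouping the `α` by the value of `collapse` turns the sum over `α` into the log-sum of the
  -- blow-up.
  have hT' := (Equiv.sigmaFiberEquiv (collapse i j)).hasSum_iff.2 hT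
  refine hT'.sigma fun γ => ?_
  refine ((hasSum_coeff_blowUpCoeff i j lam F ν γ).mul_right
    (∏ a, (w a).expMul (γ a))).congr_fun fun α => ?_
  simp only [Function.comp, Equiv.sigmaFiberEquiv_apply, hP, α.2]
  ring

/-- Termwise estimate of the norms of the blow-up for polyradii. -/
lemma radiusNorm_blowUpCoeff_le {lam r C : ℝ} (hr : 0 < r) (hlam : r < lam) (hC : lam + r ≤ C)
    (F : GenSeries (M + 1)) (ν : ℕ) {s : Fin M → ℝ} (hs : ∀ a, 0 < s a) :
    (F.blowUpCoeff i j lam ν).radiusNorm s ≤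
      ENNReal.ofReal ((r ^ ν)⁻¹) * F.radiusNorm (i.insertNth (s j * C) s) := by
  have hl : 0 < lam := hr.trans hlam
  have hC0 : 0 < C := by linarith
  have hterm : ∀ α : Fin (M + 1) → ℝ≥0,
      ‖F.coeff α * blowUpWeight lam (α i) ν‖ₑ *
        ENNReal.ofReal (∏ a, s a ^ (collapse i j α a : ℝ)) ≤
      ENNReal.ofReal ((r ^ ν)⁻¹) * (‖F.coeff α‖ₑ * ENNReal.ofReal
        (∏ b, (i.insertNth (s j * C) s : Fin (M + 1) → ℝ) b ^ (α b : ℝ))) := by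
    intro α
    rw [prod_insertNth_rpow i j (fun a => (hs a).le) hC0.le, enorm_mul,
      ← ofReal_norm (blowUpWeight lam (α i) ν), mul_assoc, ← ENNReal.ofReal_mul (norm_nonneg _),
      mul_left_comm, ← ENNReal.ofReal_mul (by positivity)]
    have hpr : 0 ≤ ∏ a, s a ^ (collapse i j α a : ℝ) :=
      Finset.prod_nonneg fun a _ => Real.rpow_nonneg (hs a).le _
    have h1 : ‖blowUpWeight lam (α i) ν‖ ≤ (r ^ ν)⁻¹ * C ^ (α i : ℝ) := by
      rw [← div_eq_inv_mul, le_div_iff₀ (by positivity)]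
      exact (norm_blowUpWeight_mul_le hr hlam (α i).coe_nonneg ν).trans
        (Real.rpow_le_rpow (by positivity) hC (α i).coe_nonneg)
    refine mul_le_mul_right (ENNReal.ofReal_le_ofReal ?_) _
    rw [← mul_assoc]
    exact mul_le_mul_of_nonneg_right h1 hpr
  calc (F.blowUpCoeff i j lam ν).radiusNorm s
      ≤ ∑' (γ : Fin M → ℝ≥0) (α : {α : Fin (M + 1) → ℝ≥0 // collapse i j α = γ}),
          ‖F.coeff α * blowUpWeight lam (α.1 i) ν‖ₑ *
            ENNReal.ofReal (∏ a, s a ^ (collapse i j α.1 a : ℝ)) := by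
        refine ENNReal.tsum_le_tsum fun γ => ?_
        rw [← (hasSum_coeff_blowUpCoeff i j lam F ν γ).tsum_eq]
        refine (mul_le_mul_left enorm_tsum_le_tsum_enorm _).trans ?_
        rw [← ENNReal.tsum_mul_right]
        exact ENNReal.tsum_le_tsum fun α => by rw [α.2]
    _ = ∑' α : Fin (M + 1) → ℝ≥0, ‖F.coeff α * blowUpWeight lam (α i) ν‖ₑ *
            ENNReal.ofReal (∏ a, s a ^ (collapse i j α a : ℝ)) := by
        rw [← ENNReal.tsum_sigma' fun x : (γ : Fin M → ℝ≥0) ×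
            {α : Fin (M + 1) → ℝ≥0 // collapse i j α = γ} =>
            ‖F.coeff x.2.1 * blowUpWeight lam (x.2.1 i) ν‖ₑ *
              ENNReal.ofReal (∏ a, s a ^ (collapse i j x.2.1 a : ℝ)),
          ← (Equiv.sigmaFiberEquiv (collapse i j)).tsum_eq]
        rfl
    _ ≤ _ := by
        rw [radiusNorm, ← ENNReal.tsum_mul_left]
        exact ENNReal.tsum_le_tsum hterm

/-- The continuous map inserting `z j * (lam + 2ρ₀)` sends `D'_p` into `D_p`, hence closure into
closure, so each polyradius allowed downstairs gives one upstairs. -/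
lemma domainNorm_blowUpCoeff_le {lam ρ₀ θ' r : ℝ} (hlam : 0 < lam) (hρ₀ : 0 < ρ₀)
    (hθ' : Real.pi / 2 < θ') (τ : MultiParam (M + 1)) (hr : 0 < r) (hr_lam : r < lam)
    (hr_le : r ≤ 2 * ρ₀) (F : GenSeries (M + 1)) (ν p : ℕ) :
    (F.blowUpCoeff i j lam ν).domainNorm ((τ.blowUp i j lam ρ₀ θ' hlam hρ₀ hθ').diskP p) ≤
      ENNReal.ofReal ((r ^ ν)⁻¹) * F.domainNorm (τ.diskP p) := by
  refine iSup₂_le fun s hs => ?_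
  have hC : 0 < lam + 2 * ρ₀ := by positivity
  refine (radiusNorm_blowUpCoeff_le i j hr hr_lam (C := lam + 2 * ρ₀) (by linarith) F ν
    hs.1).trans ?_
  gcongr
  refine le_iSup₂_of_le (i.insertNth (s j * (lam + 2 * ρ₀)) s) ⟨fun b => ?_, ?_⟩ le_rfl
  · rcases Fin.eq_self_or_eq_succAbove i b with rfl | ⟨a, rfl⟩
    · rw [Fin.insertNth_apply_same]
      exact mul_pos (hs.1 j) hC
    · rw [Fin.insertNth_apply_succAbove]
      exact hs.1 a
  · have hcont : Continuous fun z : Fin M → ℂ =>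
        (i.insertNth (z j * ((lam + 2 * ρ₀ : ℝ) : ℂ)) z : Fin (M + 1) → ℂ) := by
      refine continuous_pi fun b => ?_
      rcases Fin.eq_self_or_eq_succAbove i b with rfl | ⟨a, rfl⟩
      · simp only [Fin.insertNth_apply_same]
        fun_prop
      · simp only [Fin.insertNth_apply_succAbove]
        fun_prop
    have hmaps : MapsTo (fun z : Fin M → ℂ =>
        (i.insertNth (z j * ((lam + 2 * ρ₀ : ℝ) : ℂ)) z : Fin (M + 1) → ℂ))
        ((τ.blowUp i j lam ρ₀ θ' hlam hρ₀ hθ').diskP p) (τ.diskP p) := fun z hz =>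
      insertNth_mem_diskP i j hlam hρ₀ hθ' τ hz
        (by rw [Complex.norm_real, Real.norm_of_nonneg hC.le])
    have := hmaps.closure hcont hs.2
    convert this using 1
    funext b
    rcases Fin.eq_self_or_eq_succAbove i b with rfl | ⟨a, rfl⟩
    · simp
    · simp

/-- The entries of `α` are bounded by those of `γ`. Unlike `finite_collapse_fiber`, this gives one
finite set for all `F_p` at once. -/
lemma finite_collapse_fiber_of_isNatural {Δ : Set (Fin (M + 1) → ℝ≥0)} (h : IsNatural Δ)
    (γ : Fin M → ℝ≥0) : {α | α ∈ Δ ∧ collapse i j α = γ}.Finite := by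
  obtain ⟨A, hA, hΔ⟩ := h
  refine (Finite.pi' fun b => hA b (∑ a, γ a + 1)).subset ?_
  rintro α ⟨hα, rfl⟩ b
  refine ⟨hΔ hα b trivial, mem_Iio.2 (lt_of_le_of_lt ?_ (lt_add_one _))⟩
  rcases Fin.eq_self_or_eq_succAbove i b with rfl | ⟨a, rfl⟩
  · refine le_trans ?_ (Finset.single_le_sum (fun _ _ => zero_le) (Finset.mem_univ j))
    simp [collapse]
  · refine le_trans ?_ (Finset.single_le_sum (fun _ _ => zero_le) (Finset.mem_univ a))
    exact le_self_add

/-- Blowing up commutes with coefficientwise sums of series with support in a natural set. -/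
lemma hasSum_coeff_blowUpCoeff_of_hasSum (lam : ℝ) {Δ : Set (Fin (M + 1) → ℝ≥0)}
    (hΔ : IsNatural Δ) {Fp : ℕ → GenSeries (M + 1)} {F : GenSeries (M + 1)}
    (hFp : ∀ p, (Fp p).support ⊆ Δ) (h : ∀ α, HasSum (fun p => (Fp p).coeff α) (F.coeff α)) (ν : ℕ)
    (γ : Fin M → ℝ≥0) :
    HasSum (fun p => ((Fp p).blowUpCoeff i j lam ν).coeff γ)
      ((F.blowUpCoeff i j lam ν).coeff γ) := by
  have hzero : ∀ p, ∀ α ∉ Δ, (Fp p).coeff α = 0 := fun p α hα => by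
    by_contra h0
    exact hα (hFp p h0)
  have hzeroF : ∀ α ∉ Δ, F.coeff α = 0 := fun α hα =>
    (h α).unique (by simp only [hzero _ α hα, hasSum_zero])
  have hfin : {α : {α : Fin (M + 1) → ℝ≥0 // collapse i j α = γ} | α.1 ∈ Δ}.Finite :=
    ((finite_collapse_fiber_of_isNatural i j hΔ γ).preimage
      Subtype.val_injective.injOn).subset fun α hα => ⟨hα, α.2⟩
  -- The finite index set is independent of `G`, so the sum over `p` can be exchanged with it.
  have key : ∀ G : GenSeries (M + 1), (∀ α ∉ Δ, G.coeff α = 0) →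
      (G.blowUpCoeff i j lam ν).coeff γ =
        ∑ α ∈ hfin.toFinset, G.coeff α.1 * blowUpWeight lam (α.1 i) ν := by
    intro G hG
    refine (hasSum_coeff_blowUpCoeff i j lam G ν γ).unique (hasSum_sum_of_ne_finset_zero ?_)
    intro α hα
    rw [Finite.mem_toFinset] at hα
    rw [hG _ hα, zero_mul]
  rw [key F hzeroF]
  simp only [key _ (hzero _)]
  exact hasSum_sum fun α _ => (h α.1).mul_right _

end GenSeries

end BlowUpSeries

/-! ### Blow-ups of generalized multisummable functions -/

section BlowUpFunctions

open Metric Set Filter Topology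

lemma enorm_le_supNormOn {X : Type} (f : X → ℂ) {D : Set X} {x : X} (hx : x ∈ D) :
    ‖f x‖ₑ ≤ supNormOn f D := le_iSup₂_of_le x hx le_rfl

lemma norm_le_toReal_supNormOn {X : Type} {f : X → ℂ} {D : Set X} (hD : supNormOn f D ≠ ⊤) {x : X}
    (hx : x ∈ D) : ‖f x‖ ≤ (supNormOn f D).toReal := by
  rw [← toReal_enorm]
  exact ENNReal.toReal_mono hD (enorm_le_supNormOn f hx)

namespace MultiParam

variable {m : ℕ} {τ : MultiParam m}

lemma one_le_ofReal_r_pow (τ : MultiParam m) (p : ℕ) : 1 ≤ ENNReal.ofReal (τ.r ^ p) :=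
  ENNReal.one_le_ofReal.2 (one_le_pow₀ τ.one_lt_r.le)

lemma tsum_supNormOn_le_funSum (τ : MultiParam m) (fp : ℕ → (Fin m → LogPlane) → ℂ) :
    ∑' p, supNormOn (fp p) (τ.SP p) ≤ τ.funSum fp :=
  ENNReal.tsum_le_tsum fun p => le_mul_of_one_le_right' (τ.one_le_ofReal_r_pow p)

lemma IsDecomposition.tsum_supNormOn_ne_top {f fp Fp} (h : τ.IsDecomposition f fp Fp) :
    ∑' p, supNormOn (fp p) (τ.SP p) ≠ ⊤ :=
  ((τ.tsum_supNormOn_le_funSum fp).trans_lt h.funSum_lt_top).ne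

lemma enorm_le_funNorm (f : (Fin m → LogPlane) → ℂ) {w : Fin m → LogPlane} (hw : w ∈ τ.S) :
    ‖f w‖ₑ ≤ τ.funNorm f := by
  refine le_iInf fun fp => le_iInf fun Fp => le_iInf fun h => le_max_of_le_right ?_
  rw [← (h.hasSum w hw).tsum_eq]
  exact enorm_tsum_le_tsum_enorm.trans ((ENNReal.tsum_le_tsum fun p =>
    enorm_le_supNormOn (fp p) (τ.S_subset_SP p hw)).trans (τ.tsum_supNormOn_le_funSum fp))

lemma IsDecomposition.funNorm_le {f fp Fp} (h : τ.IsDecomposition f fp Fp) :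
    τ.funNorm f ≤ max (τ.seriesSum Fp) (τ.funSum fp) :=
  iInf_le_of_le fp <| iInf_le_of_le Fp <| iInf_le_of_le h le_rfl

lemma HasExpansion.seriesNorm_le {f F} (h : τ.HasExpansion f F) :
    τ.seriesNorm F ≤ τ.funNorm f := iInf_le_of_le f <| iInf_le_of_le h le_rfl

lemma HasExpansion.funNorm_lt_top {f F} (h : τ.HasExpansion f F) : τ.funNorm f < ⊤ := by
  obtain ⟨fp, Fp, hd, -⟩ := h
  exact hd.funNorm_le.trans_lt (max_lt hd.seriesSum_lt_top hd.funSum_lt_top)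

end MultiParam

variable {M : ℕ} (i : Fin (M + 1)) (j : Fin M)

/-- The coefficients of the expansion of `f`, composed with the blow-up map, in powers of the new
variable. -/
noncomputable def blowUpFun (lam : ℝ) (f : (Fin (M + 1) → LogPlane) → ℂ) (ν : ℕ)
    (w : Fin M → LogPlane) : ℂ := taylorCoeff (fun v => f (blowUpPoint i j lam w v)) ν

variable {lam ρ₀ θ' : ℝ} (hlam : 0 < lam) (hρ₀ : 0 < ρ₀) (hθ' : Real.pi / 2 < θ')
  (hρ₀_lt : 2 * ρ₀ < lam) (τ : MultiParam (M + 1))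
  (harg : ∀ k ∈ τ.K, ∀ v : ℂ, ‖v‖ < 2 * ρ₀ → (k i : ℝ) * |Complex.arg (lam + v)| < τ.θ - θ')

include hρ₀_lt harg in
lemma continuousOn_comp_blowUpPoint {f : (Fin (M + 1) → LogPlane) → ℂ} {p : ℕ}
    (hf : ContinuousOn f (τ.SP p)) :
    ContinuousOn (fun w v => f (blowUpPoint i j lam w v)).uncurry
      ((τ.blowUp i j lam ρ₀ θ' hlam hρ₀ hθ').SP p ×ˢ ball 0 (2 * ρ₀)) := by
  refine hf.comp ((continuousOn_blowUpPoint i j lam).mono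
    (prod_mono (subset_univ _) (ball_subset_ball hρ₀_lt.le))) fun x hx => ?_
  exact blowUpPoint_mem_SP i j hlam hρ₀ hθ' hρ₀_lt τ harg hx.1 (mem_ball_zero_iff.1 hx.2)

include hρ₀_lt harg in
lemma differentiableOn_comp_blowUpFinite {f : (Fin (M + 1) → LogPlane) → ℂ} {p : ℕ}
    (hf : LogHolomorphicOn f (τ.SP p)) :
    DifferentiableOn ℂ
      (fun (z : Fin M → ℂ) v => f (blowUpPoint i j lam (fun a => LogPlane.fin (z a)) v)).uncurry
      ({z | (fun a => LogPlane.fin (z a)) ∈ (τ.blowUp i j lam ρ₀ θ' hlam hρ₀ hθ').SP p} ×ˢ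
        ball 0 (2 * ρ₀)) := by
  have h := hf.2.comp ((differentiableOn_blowUpFinite i j lam).mono
    (prod_mono (subset_univ _) (ball_subset_ball hρ₀_lt.le)))
    (s := {z | (fun a => LogPlane.fin (z a)) ∈ (τ.blowUp i j lam ρ₀ θ' hlam hρ₀ hθ').SP p} ×ˢ
        ball 0 (2 * ρ₀)) fun x hx => ?_
  · refine h.congr fun x _ => ?_
    simp only [Function.uncurry, Function.comp, blowUpPoint_fin]
  · change (fun b => LogPlane.fin (blowUpFinite i j lam x.1 x.2 b)) ∈ τ.SP p
    rw [← blowUpPoint_fin]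
    exact blowUpPoint_mem_SP i j hlam hρ₀ hθ' hρ₀_lt τ harg hx.1 (mem_ball_zero_iff.1 hx.2)

include hρ₀_lt harg in
-- For finite `w` this is a composition of holomorphic maps; points with entries `-∞` are limits of
-- finite ones, and holomorphy in `v` survives the limit.
lemma differentiableOn_comp_blowUpPoint {f : (Fin (M + 1) → LogPlane) → ℂ} {p : ℕ}
    (hf : LogHolomorphicOn f (τ.SP p)) {w : Fin M → LogPlane}
    (hw : w ∈ (τ.blowUp i j lam ρ₀ θ' hlam hρ₀ hθ').SP p) :
    DifferentiableOn ℂ (fun v => f (blowUpPoint i j lam w v)) (ball 0 (2 * ρ₀)) := by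
  refine differentiableOn_of_dense_parameters (G := fun w v => f (blowUpPoint i j lam w v))
    (continuousOn_comp_blowUpPoint i j hlam hρ₀ hθ' hρ₀_lt τ harg hf.1) (sep_subset _ _) ?_ hw
    (MultiParam.SP_subset_closure_finite _ p hw)
  rintro _ ⟨hz, z, rfl⟩
  exact (differentiableOn_comp_blowUpFinite i j hlam hρ₀ hθ' hρ₀_lt τ harg hf).comp
    (f := fun v : ℂ => (z, v)) (by fun_prop) fun v hv => ⟨hz, hv⟩

include hρ₀_lt harg in
lemma logHolomorphicOn_blowUpFun {f : (Fin (M + 1) → LogPlane) → ℂ} {p : ℕ}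
    (hf : LogHolomorphicOn f (τ.SP p)) (ν : ℕ) :
    LogHolomorphicOn (blowUpFun i j lam f ν) ((τ.blowUp i j lam ρ₀ θ' hlam hρ₀ hθ').SP p) :=
  ⟨continuousOn_taylorCoeff (by positivity : 0 < 2 * ρ₀)
      (continuousOn_comp_blowUpPoint i j hlam hρ₀ hθ' hρ₀_lt τ harg hf.1)
      (fun _ hw => differentiableOn_comp_blowUpPoint i j hlam hρ₀ hθ' hρ₀_lt τ harg hf hw) ν,
    differentiableOn_taylorCoeff (MultiParam.isOpen_finite_SP _ p) (by positivity : 0 < 2 * ρ₀)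
      (differentiableOn_comp_blowUpFinite i j hlam hρ₀ hθ' hρ₀_lt τ harg hf) ν⟩

variable {r : ℝ} (hr : 0 < r) (hr_lt : r < 2 * ρ₀)

include hρ₀_lt harg hr hr_lt in
lemma norm_blowUpFun_le {f : (Fin (M + 1) → LogPlane) → ℂ} {p : ℕ}
    (hf : LogHolomorphicOn f (τ.SP p)) (hfin : supNormOn f (τ.SP p) ≠ ⊤) (ν : ℕ)
    {w : Fin M → LogPlane} (hw : w ∈ (τ.blowUp i j lam ρ₀ θ' hlam hρ₀ hθ').SP p) :
    ‖blowUpFun i j lam f ν w‖ ≤ (supNormOn f (τ.SP p)).toReal / r ^ ν := by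
  refine norm_taylorCoeff_le hr
    ((differentiableOn_comp_blowUpPoint i j hlam hρ₀ hθ' hρ₀_lt τ harg hf hw).mono
      (closedBall_subset_ball hr_lt)) (fun v hv => ?_) ν
  refine norm_le_toReal_supNormOn hfin (blowUpPoint_mem_SP i j hlam hρ₀ hθ' hρ₀_lt τ harg hw ?_)
  rwa [mem_sphere_zero_iff_norm.1 hv]

include hρ₀_lt harg hr hr_lt in
lemma supNormOn_blowUpFun_le {f : (Fin (M + 1) → LogPlane) → ℂ} {p : ℕ}
    (hf : LogHolomorphicOn f (τ.SP p)) (ν : ℕ) :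
    supNormOn (blowUpFun i j lam f ν) ((τ.blowUp i j lam ρ₀ θ' hlam hρ₀ hθ').SP p) ≤
      ENNReal.ofReal ((r ^ ν)⁻¹) * supNormOn f (τ.SP p) := by
  by_cases hfin : supNormOn f (τ.SP p) = ⊤
  · rw [hfin, ENNReal.mul_top (by simpa using pow_pos hr ν)]
    exact le_top
  · refine iSup₂_le fun w hw => ?_
    rw [← ENNReal.ofReal_toReal hfin, ← ENNReal.ofReal_mul (by positivity), ← ofReal_norm,
      ← div_eq_inv_mul]
    exact ENNReal.ofReal_le_ofReal
      (norm_blowUpFun_le i j hlam hρ₀ hθ' hρ₀_lt τ harg hr hr_lt hf hfin ν hw)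

variable {f : (Fin (M + 1) → LogPlane) → ℂ} {fp : ℕ → (Fin (M + 1) → LogPlane) → ℂ}
  {Fp : ℕ → GenSeries (M + 1)}

include hρ₀_lt harg hr hr_lt in
lemma funSum_blowUpFun_le (h : τ.IsDecomposition f fp Fp) (ν : ℕ) :
    (τ.blowUp i j lam ρ₀ θ' hlam hρ₀ hθ').funSum (fun p => blowUpFun i j lam (fp p) ν) ≤
      ENNReal.ofReal ((r ^ ν)⁻¹) * τ.funSum fp := by
  rw [MultiParam.funSum, MultiParam.funSum, ← ENNReal.tsum_mul_left]
  refine ENNReal.tsum_le_tsum fun p => ?_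
  rw [← mul_assoc]
  exact mul_le_mul_left (supNormOn_blowUpFun_le i j hlam hρ₀ hθ' hρ₀_lt τ harg hr hr_lt
    (h.logHolomorphic p) ν) _

include hρ₀_lt hr hr_lt in
lemma seriesSum_blowUpCoeff_le (Fp : ℕ → GenSeries (M + 1)) (ν : ℕ) :
    (τ.blowUp i j lam ρ₀ θ' hlam hρ₀ hθ').seriesSum (fun p => (Fp p).blowUpCoeff i j lam ν) ≤
      ENNReal.ofReal ((r ^ ν)⁻¹) * τ.seriesSum Fp := by
  rw [MultiParam.seriesSum, MultiParam.seriesSum, ← ENNReal.tsum_mul_left]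
  refine ENNReal.tsum_le_tsum fun p => ?_
  rw [← mul_assoc]
  exact mul_le_mul_left (GenSeries.domainNorm_blowUpCoeff_le i j hlam hρ₀ hθ' τ hr
    (hr_lt.trans hρ₀_lt) hr_lt.le (Fp p) ν p) _

include hρ₀_lt harg hr hr_lt in
-- The rearrangement lemma with the sup norms of the `f_p` as majorants. It yields the expansion of
-- `f` itself without a separate proof that `f` is holomorphic.
lemma hasSum_blowUpFun (h : τ.IsDecomposition f fp Fp) {w : Fin M → LogPlane}
    (hw : w ∈ (τ.blowUp i j lam ρ₀ θ' hlam hρ₀ hθ').S) :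
    (∀ ν, HasSum (fun p => blowUpFun i j lam (fp p) ν w) (blowUpFun i j lam f ν w)) ∧
      ∀ v, ‖v‖ < r →
        HasSum (fun ν => blowUpFun i j lam f ν w * v ^ ν) (f (blowUpPoint i j lam w v)) := by
  have hS : ∀ p, w ∈ (τ.blowUp i j lam ρ₀ θ' hlam hρ₀ hθ').SP p := fun p =>
    MultiParam.S_subset_SP _ p hw
  refine hasSum_rearrange (φ := fun v => f (blowUpPoint i j lam w v))
    (ψ := fun p v => fp p (blowUpPoint i j lam w v))
    (c := fun p ν => blowUpFun i j lam (fp p) ν w) hr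
    (ENNReal.summable_toReal h.tsum_supNormOn_ne_top) (fun p ν => ?_) (fun p v hv => ?_)
    fun v hv => ?_
  · rw [← le_div_iff₀ (by positivity)]
    exact norm_blowUpFun_le i j hlam hρ₀ hθ' hρ₀_lt τ harg hr hr_lt (h.logHolomorphic p)
      (ENNReal.ne_top_of_tsum_ne_top h.tsum_supNormOn_ne_top p) ν (hS p)
  · exact hasSum_taylorCoeff (differentiableOn_comp_blowUpPoint i j hlam hρ₀ hθ' hρ₀_lt τ harg
      (h.logHolomorphic p) (hS p)) (hv.trans hr_lt)
  · exact h.hasSum _ (blowUpPoint_mem_S i j hlam hρ₀ hθ' hρ₀_lt τ harg hw (hv.trans hr_lt))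

include hρ₀_lt harg in
-- Only finiteness of the norms matters here, so the Cauchy radius is simply `ρ₀`; the sharper
-- radius enters in the norm estimates.
lemma IsDecomposition.blowUp (h : τ.IsDecomposition f fp Fp) (ν : ℕ) :
    (τ.blowUp i j lam ρ₀ θ' hlam hρ₀ hθ').IsDecomposition (blowUpFun i j lam f ν)
      (fun p => blowUpFun i j lam (fp p) ν) (fun p => (Fp p).blowUpCoeff i j lam ν) where
  logHolomorphic p :=
    logHolomorphicOn_blowUpFun i j hlam hρ₀ hθ' hρ₀_lt τ harg (h.logHolomorphic p) ν
  support_subset p := GenSeries.blowUpCoeff_support_subset i j lam (h.support_subset p) ν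
  hasLogSum p w hw := GenSeries.hasLogSumAt_blowUpCoeff i j hρ₀ (by linarith) (fun v hv =>
    h.hasLogSum p _ (blowUpPoint_mem_logDiskP i j hlam hρ₀ hθ' hρ₀_lt τ hw (by linarith))) ν
  seriesSum_lt_top :=
    (seriesSum_blowUpCoeff_le i j hlam hρ₀ hθ' hρ₀_lt τ hρ₀ (by linarith) Fp ν).trans_lt
      (ENNReal.mul_lt_top ENNReal.ofReal_lt_top h.seriesSum_lt_top)
  funSum_lt_top :=
    (funSum_blowUpFun_le i j hlam hρ₀ hθ' hρ₀_lt τ harg hρ₀ (by linarith) h ν).trans_lt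
      (ENNReal.mul_lt_top ENNReal.ofReal_lt_top h.funSum_lt_top)
  hasSum w hw := (hasSum_blowUpFun i j hlam hρ₀ hθ' hρ₀_lt τ harg hρ₀ (by linarith) h hw).1 ν

include hρ₀_lt harg in
lemma HasExpansion.blowUp {F : GenSeries (M + 1)} (h : τ.HasExpansion f F) (ν : ℕ) :
    (τ.blowUp i j lam ρ₀ θ' hlam hρ₀ hθ').HasExpansion (blowUpFun i j lam f ν)
      (F.blowUpCoeff i j lam ν) := by
  obtain ⟨fp, Fp, hd, hF⟩ := h
  exact ⟨_, _, IsDecomposition.blowUp i j hlam hρ₀ hθ' hρ₀_lt τ harg hd ν,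
    GenSeries.hasSum_coeff_blowUpCoeff_of_hasSum i j lam τ.natural hd.support_subset hF ν⟩

include hr in
lemma ofReal_inv_pow_ne_zero (ν : ℕ) : ENNReal.ofReal ((r ^ ν)⁻¹) ≠ 0 := by
  simpa using pow_pos hr ν

include hρ₀_lt harg hr hr_lt in
lemma funNorm_blowUpFun_le (f : (Fin (M + 1) → LogPlane) → ℂ) (ν : ℕ) :
    (τ.blowUp i j lam ρ₀ θ' hlam hρ₀ hθ').funNorm (blowUpFun i j lam f ν) ≤
      ENNReal.ofReal ((r ^ ν)⁻¹) * τ.funNorm f := by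
  -- The factor must be nonzero and finite to be moved inside the infimum, which may run over no
  -- decomposition at all.
  have hc := ofReal_inv_pow_ne_zero hr ν
  have hc' : ENNReal.ofReal ((r ^ ν)⁻¹) ≠ ⊤ := ENNReal.ofReal_ne_top
  rw [MultiParam.funNorm.eq_def τ]
  simp only [ENNReal.mul_iInf_of_ne hc hc']
  refine le_iInf fun fp => le_iInf fun Fp => le_iInf fun h => ?_
  refine (IsDecomposition.blowUp i j hlam hρ₀ hθ' hρ₀_lt τ harg h ν).funNorm_le.trans
    (max_le ?_ ?_)
  · exact (seriesSum_blowUpCoeff_le i j hlam hρ₀ hθ' hρ₀_lt τ hr hr_lt Fp ν).trans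
      (mul_le_mul_right (le_max_left _ _) _)
  · exact (funSum_blowUpFun_le i j hlam hρ₀ hθ' hρ₀_lt τ harg hr hr_lt h ν).trans
      (mul_le_mul_right (le_max_right _ _) _)

include hρ₀_lt harg hr hr_lt in
lemma seriesNorm_blowUpCoeff_le (F : GenSeries (M + 1)) (ν : ℕ) :
    (τ.blowUp i j lam ρ₀ θ' hlam hρ₀ hθ').seriesNorm (F.blowUpCoeff i j lam ν) ≤
      ENNReal.ofReal ((r ^ ν)⁻¹) * τ.seriesNorm F := by
  have hc := ofReal_inv_pow_ne_zero hr ν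
  have hc' : ENNReal.ofReal ((r ^ ν)⁻¹) ≠ ⊤ := ENNReal.ofReal_ne_top
  rw [MultiParam.seriesNorm.eq_def τ]
  simp only [ENNReal.mul_iInf_of_ne hc hc']
  refine le_iInf fun f => le_iInf fun h => ?_
  exact (HasExpansion.blowUp i j hlam hρ₀ hθ' hρ₀_lt τ harg h ν).seriesNorm_le.trans
    (funNorm_blowUpFun_le i j hlam hρ₀ hθ' hρ₀_lt τ harg hr hr_lt f ν)

end BlowUpFunctions

/-! ### Blow-ups of mixed series -/

section MixedBlowUp

open Metric Set Filter Topology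

/-- Multi-indices of length `n + 1` as pairs of the first entry and the remaining ones. -/
noncomputable def finsuppConsEquiv (n : ℕ) : ℕ × (Fin n →₀ ℕ) ≃ (Fin (n + 1) →₀ ℕ) where
  toFun x := Finsupp.cons x.1 x.2
  invFun β := (β 0, Finsupp.tail β)
  left_inv x := by simp
  right_inv β := by simp

variable {n : ℕ}

lemma prod_cons_pow {R : Type*} [CommMonoid R] (x : Fin (n + 1) → R) (ν : ℕ) (β : Fin n →₀ ℕ) :
    ∏ l, x l ^ (Finsupp.cons ν β : Fin (n + 1) →₀ ℕ) l = x 0 ^ ν * ∏ l, Fin.tail x l ^ β l := by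
  rw [Fin.prod_univ_succ]
  simp [Fin.tail]

/-- The Cauchy radius `(3/2) ρ₀` lies strictly between `ρ₀`, for convergence, and `2ρ₀`, where
holomorphy ends; this is the origin of the constant `3`. -/
lemma tsum_ofReal_geometric {ρ₀ : ℝ} (hρ₀ : 0 < ρ₀) :
    ∑' ν : ℕ, ENNReal.ofReal ((((3 / 2) * ρ₀) ^ ν)⁻¹) * ENNReal.ofReal (ρ₀ ^ ν) = 3 := by
  have h : ∀ ν : ℕ, ENNReal.ofReal ((((3 / 2) * ρ₀) ^ ν)⁻¹) * ENNReal.ofReal (ρ₀ ^ ν) =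
      ENNReal.ofReal ((2 / 3 : ℝ) ^ ν) := by
    intro ν
    rw [← ENNReal.ofReal_mul (by positivity), ← inv_pow, ← mul_pow]
    congr 2
    field_simp
  simp only [h]
  rw [← ENNReal.ofReal_tsum_of_nonneg (fun ν => by positivity)
    (summable_geometric_of_lt_one (by norm_num) (by norm_num)),
    tsum_geometric_of_lt_one (by norm_num) (by norm_num)]
  norm_num

/-- Geometric decay in the new variable costs only a constant factor. -/
lemma tsum_cons_weight_le {ρ₀ : ℝ} (hρ₀ : 0 < ρ₀) (ρ : Fin n → ℝ) {a : (Fin n →₀ ℕ) → ℝ≥0∞}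
    {b : (Fin (n + 1) →₀ ℕ) → ℝ≥0∞}
    (h : ∀ β, b β ≤ ENNReal.ofReal ((((3 / 2) * ρ₀) ^ β 0)⁻¹) * a (Finsupp.tail β)) :
    ∑' β : Fin (n + 1) →₀ ℕ,
        b β * ENNReal.ofReal (∏ l, (Fin.cons ρ₀ ρ : Fin (n + 1) → ℝ) l ^ β l) ≤
      3 * ∑' β : Fin n →₀ ℕ, a β * ENNReal.ofReal (∏ l, ρ l ^ β l) := by
  rw [← (finsuppConsEquiv n).tsum_eq, ENNReal.tsum_prod', ← tsum_ofReal_geometric hρ₀,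
    ← ENNReal.tsum_mul_right]
  refine ENNReal.tsum_le_tsum fun ν => ?_
  rw [← ENNReal.tsum_mul_left]
  refine ENNReal.tsum_le_tsum fun β => ?_
  change b (Finsupp.cons ν β) * ENNReal.ofReal
    (∏ l, (Fin.cons ρ₀ ρ : Fin (n + 1) → ℝ) l ^ (Finsupp.cons ν β : Fin (n + 1) →₀ ℕ) l) ≤ _
  have hb := h (Finsupp.cons ν β)
  rw [Finsupp.cons_zero, Finsupp.tail_cons] at hb
  rw [prod_cons_pow, Fin.cons_zero, Fin.tail_cons, ENNReal.ofReal_mul (by positivity)]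
  calc _ ≤ ENNReal.ofReal ((((3 / 2) * ρ₀) ^ ν)⁻¹) * a β *
        (ENNReal.ofReal (ρ₀ ^ ν) * ENNReal.ofReal (∏ l, ρ l ^ β l)) := mul_le_mul_left hb _
    _ = _ := by ring

variable {m : ℕ}

lemma summable_mixed (τ : MultiParam m) (ρ : Fin n → ℝ)
    {f : (Fin n →₀ ℕ) → (Fin m → LogPlane) → ℂ}
    (hf : ∑' β : Fin n →₀ ℕ, τ.funNorm (f β) * ENNReal.ofReal (∏ j, ρ j ^ β j) < ⊤)
    {w : Fin m → LogPlane} (hw : w ∈ τ.S) {y : Fin n → ℂ} (hy : y ∈ polydisk ρ) :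
    Summable fun β : Fin n →₀ ℕ => f β w * ∏ j, y j ^ β j := by
  have hle : ∀ β : Fin n →₀ ℕ, ‖f β w * ∏ j, y j ^ β j‖ₑ ≤
      τ.funNorm (f β) * ENNReal.ofReal (∏ j, ρ j ^ β j) := by
    intro β
    rw [enorm_mul]
    refine mul_le_mul' (MultiParam.enorm_le_funNorm _ hw) ?_
    rw [← ofReal_norm, norm_prod]
    refine ENNReal.ofReal_le_ofReal (Finset.prod_le_prod (fun _ _ => norm_nonneg _) fun j _ => ?_)
    rw [norm_pow]
    exact pow_le_pow_left₀ (norm_nonneg _) (hy j).le _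
  have hsum := ENNReal.summable_toReal ((ENNReal.tsum_le_tsum hle).trans_lt hf).ne
  simp only [toReal_enorm] at hsum
  exact hsum.of_norm

/-- `seriesNorm` is an infimum over all sums of `F_β`, so `f_β` is chosen within `δ_β / ρ^β` of it,
with `δ` summable. This avoids any appeal to injectivity of `T`. -/
lemma MultiParam.exists_isMixedSum (τ : MultiParam m) {ρ : Fin n → ℝ} (hρ : ∀ l, 0 < ρ l)
    {F : MixedSeries m n} (hF : F ∈ τ.mixedSeries ρ) : ∃ g, τ.IsMixedSum ρ F g := by
  obtain ⟨δ, hδ, hδsum⟩ := ENNReal.exists_pos_sum_of_countable' one_ne_zero (Fin n →₀ ℕ)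
  have hw : ∀ β : Fin n →₀ ℕ, ENNReal.ofReal (∏ j, ρ j ^ β j) ≠ 0 := fun β => by
    simpa using Finset.prod_pos fun j _ => pow_pos (hρ j) (β j)
  have hex : ∀ β, ∃ f, τ.HasExpansion f (MvPowerSeries.coeff β F) ∧
      τ.funNorm f ≤ τ.seriesNorm (MvPowerSeries.coeff β F) +
        δ β / ENNReal.ofReal (∏ j, ρ j ^ β j) := by
    intro β
    obtain ⟨f₀, hf₀⟩ := hF.1 β
    have hlt : τ.seriesNorm (MvPowerSeries.coeff β F) <
        τ.seriesNorm (MvPowerSeries.coeff β F) + δ β / ENNReal.ofReal (∏ j, ρ j ^ β j) :=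
      ENNReal.lt_add_right (hf₀.seriesNorm_le.trans_lt hf₀.funNorm_lt_top).ne
        (ENNReal.div_pos (hδ β).ne' ENNReal.ofReal_ne_top).ne'
    nth_rewrite 1 [seriesNorm] at hlt
    obtain ⟨f, hf⟩ := iInf_lt_iff.1 hlt
    obtain ⟨hf, hf'⟩ := iInf_lt_iff.1 hf
    exact ⟨f, hf, hf'.le⟩
  choose f hf hfn using hex
  have hfin : ∑' β : Fin n →₀ ℕ, τ.funNorm (f β) * ENNReal.ofReal (∏ j, ρ j ^ β j) < ⊤ := by
    calc _ ≤ ∑' β : Fin n →₀ ℕ, (τ.seriesNorm (MvPowerSeries.coeff β F) *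
          ENNReal.ofReal (∏ j, ρ j ^ β j) + δ β) := by
          refine ENNReal.tsum_le_tsum fun β => (mul_le_mul_left (hfn β) _).trans ?_
          rw [add_mul, ENNReal.div_mul_cancel (hw β) ENNReal.ofReal_ne_top]
      _ = τ.mixedNorm ρ F + ∑' β, δ β := ENNReal.tsum_add
      _ < ⊤ := ENNReal.add_lt_top.2 ⟨hF.2, hδsum.trans ENNReal.one_lt_top⟩
  exact ⟨fun x => ∑' β : Fin n →₀ ℕ, f β x.1 * ∏ j, x.2 j ^ β j, f, hf, hfin,
    fun w hw y hy => (summable_mixed τ ρ hfin hw hy).hasSum⟩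

variable {M : ℕ} (i : Fin (M + 1)) (j : Fin M)
variable {lam ρ₀ θ' : ℝ} (hlam : 0 < lam) (hρ₀ : 0 < ρ₀) (hθ' : Real.pi / 2 < θ')
  (hρ₀_lt : 2 * ρ₀ < lam) (τ : MultiParam (M + 1))
  (harg : ∀ k ∈ τ.K, ∀ v : ℂ, ‖v‖ < 2 * ρ₀ → (k i : ℝ) * |Complex.arg (lam + v)| < τ.θ - θ')

include hρ₀_lt harg in
lemma MultiParam.IsMixedSum.blowUp {ρ : Fin n → ℝ} {F : MixedSeries (M + 1) n}
    {g : (Fin (M + 1) → LogPlane) × (Fin n → ℂ) → ℂ} (hg : τ.IsMixedSum ρ F g) :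
    (τ.blowUp i j lam ρ₀ θ' hlam hρ₀ hθ').IsMixedSum (Fin.cons ρ₀ ρ : Fin (n + 1) → ℝ)
      (F.blowUp i j lam) (g ∘ blowUpMap i j lam) := by
  obtain ⟨f, hf, hfin, hsum⟩ := hg
  have hr : 0 < 3 / 2 * ρ₀ := by positivity
  have hr_lt : 3 / 2 * ρ₀ < 2 * ρ₀ := by linarith
  have hfin' : ∑' β : Fin (n + 1) →₀ ℕ, (τ.blowUp i j lam ρ₀ θ' hlam hρ₀ hθ').funNorm
      (blowUpFun i j lam (f (Finsupp.tail β)) (β 0)) *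
        ENNReal.ofReal (∏ l, (Fin.cons ρ₀ ρ : Fin (n + 1) → ℝ) l ^ β l) < ⊤ :=
    (tsum_cons_weight_le hρ₀ ρ fun β => funNorm_blowUpFun_le i j hlam hρ₀ hθ' hρ₀_lt τ harg hr
      hr_lt (f (Finsupp.tail β)) (β 0)).trans_lt (ENNReal.mul_lt_top (by simp) hfin)
  refine ⟨fun β => blowUpFun i j lam (f (Finsupp.tail β)) (β 0), fun β =>
    HasExpansion.blowUp i j hlam hρ₀ hθ' hρ₀_lt τ harg (hf (Finsupp.tail β)) (β 0), hfin', ?_⟩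
  intro w hw y hy
  have hy0 : ‖y 0‖ < ρ₀ := by simpa using hy 0
  have hyt : Fin.tail y ∈ polydisk ρ := fun l => by simpa [Fin.tail] using hy l.succ
  have hwS : blowUpPoint i j lam w (y 0) ∈ τ.S :=
    blowUpPoint_mem_S i j hlam hρ₀ hθ' hρ₀_lt τ harg hw (by linarith)
  -- Summability of the whole family is known first; its value `s` is then computed by iterated
  -- summation, `ν` inside and `β` outside.
  obtain ⟨s, hs⟩ := summable_mixed _ _ hfin' hw hy
  have hs' : HasSum (fun x : (Fin n →₀ ℕ) × ℕ => blowUpFun i j lam (f x.1) x.2 w * y 0 ^ x.2 *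
      ∏ l, Fin.tail y l ^ x.1 l) s := by
    refine (((Equiv.prodComm _ _).trans (finsuppConsEquiv n)).hasSum_iff.2 hs).congr_fun
      fun x => Eq.symm ?_
    change blowUpFun i j lam (f (Finsupp.tail (Finsupp.cons x.2 x.1)))
      ((Finsupp.cons x.2 x.1 : Fin (n + 1) →₀ ℕ) 0) w *
        ∏ l, y l ^ (Finsupp.cons x.2 x.1 : Fin (n + 1) →₀ ℕ) l = _
    rw [prod_cons_pow, Finsupp.tail_cons, Finsupp.cons_zero, mul_assoc]
  have hfib := hs'.prod_fiberwise fun β => by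
    obtain ⟨fp, Fp, hd, -⟩ := hf β
    exact ((hasSum_blowUpFun i j hlam hρ₀ hθ' hρ₀_lt τ harg hr hr_lt hd hw).2 (y 0)
      (by linarith)).mul_right (∏ l, Fin.tail y l ^ β l)
  have hval := hfib.unique (hsum _ hwS _ hyt)
  rw [hval] at hs
  exact hs

include hρ₀_lt harg in
lemma mixedNorm_blowUp_le (ρ : Fin n → ℝ) (F : MixedSeries (M + 1) n) :
    (τ.blowUp i j lam ρ₀ θ' hlam hρ₀ hθ').mixedNorm (Fin.cons ρ₀ ρ : Fin (n + 1) → ℝ)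
      (F.blowUp i j lam) ≤ 3 * τ.mixedNorm ρ F :=
  tsum_cons_weight_le hρ₀ ρ fun β => seriesNorm_blowUpCoeff_le i j hlam hρ₀ hθ' hρ₀_lt τ harg
    (by positivity) (by linarith) (MvPowerSeries.coeff (Finsupp.tail β) F) (β 0)

end MixedBlowUp

theorem mainTheorem8 {M n : ℕ} (i : Fin (M + 1)) (j : Fin M)
    (τ : MultiParam (M + 1)) (ρ : Fin n → ℝ) (hρ : ∀ l, 0 < ρ l)
    (lam : ℝ) (hlam : 0 < lam)
    (θ' : ℝ) (hθ' : Real.pi / 2 < θ') (hθ'_lt : θ' < τ.θ)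
    (ρ₀ : ℝ) (hρ₀ : 0 < ρ₀) (hρ₀_lt : 2 * ρ₀ < lam)
    (harg : ∀ k ∈ τ.K, ∀ v : ℂ, ‖v‖ < 2 * ρ₀ → (k i : ℝ) * |Complex.arg (lam + v)| < τ.θ - θ') :
    Set.MapsTo (blowUpMap (n := n) i j lam)
        ((τ.blowUp i j lam ρ₀ θ' hlam hρ₀ hθ').S ×ˢ polydisk (Fin.cons ρ₀ ρ : Fin (n + 1) → ℝ))
        (τ.S ×ˢ polydisk ρ) ∧
      ∃ C : ℝ≥0, 1 ≤ C ∧ ∀ F ∈ τ.mixedSeries ρ,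
        F.blowUp i j lam ∈
            (τ.blowUp i j lam ρ₀ θ' hlam hρ₀ hθ').mixedSeries (Fin.cons ρ₀ ρ : Fin (n + 1) → ℝ) ∧
          (∃ g, τ.IsMixedSum ρ F g) ∧
          (∀ g, τ.IsMixedSum ρ F g →
            (τ.blowUp i j lam ρ₀ θ' hlam hρ₀ hθ').IsMixedSum (Fin.cons ρ₀ ρ : Fin (n + 1) → ℝ)
              (F.blowUp i j lam) (g ∘ blowUpMap i j lam)) ∧
          (τ.blowUp i j lam ρ₀ θ' hlam hρ₀ hθ').mixedNorm (Fin.cons ρ₀ ρ : Fin (n + 1) → ℝ)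
              (F.blowUp i j lam) ≤ C * τ.mixedNorm ρ F := by
  refine ⟨?_, 3, by norm_num, fun F hF => ?_⟩
  · rintro ⟨w, y⟩ ⟨hw, hy⟩
    have hy0 : ‖y 0‖ < ρ₀ := by simpa using hy 0
    exact ⟨blowUpPoint_mem_S i j hlam hρ₀ hθ' hρ₀_lt τ harg hw (by linarith),
      fun l => by simpa [blowUpMap, Fin.tail] using hy l.succ⟩
  · have hnorm := mixedNorm_blowUp_le i j hlam hρ₀ hθ' hρ₀_lt τ harg ρ F
    refine ⟨⟨fun β => ?_, hnorm.trans_lt (ENNReal.mul_lt_top (by simp) hF.2)⟩,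
      τ.exists_isMixedSum hρ hF,
      fun g hg => MultiParam.IsMixedSum.blowUp i j hlam hρ₀ hθ' hρ₀_lt τ harg hg,
      by simpa using hnorm⟩
    -- Any sum of the tail coefficient works, since its Taylor coefficient of index `β 0` is a sum
    -- of the blown-up one.
    obtain ⟨f, hf⟩ := hF.1 (Finsupp.tail β)
    exact ⟨_, HasExpansion.blowUp i j hlam hρ₀ hθ' hρ₀_lt τ harg hf (β 0)⟩
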